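/- Let $L$ be a homogeneous real-valued Lévy basis on $\mathbb{R}\times\mathbb{R}$ with characteristic triplet $(\zeta,a,\nu)$, that is, an independently scattered, infinitely divisible random measure on the bounded Borel sets with $\mathbb{E}\,e^{i\theta L(A)}=\exp(\mathrm{Leb}(A)\psi(\theta))$, $\psi(\theta)=i\theta\zeta-\tfrac12\theta^2a+\int_{\mathbb{R}}(e^{i\theta\xi}-1-i\theta\xi\mathbf 1_{[-1,1]}(\xi))\,\nu(d\xi)$, where $a\ge 0$ and $\nu$ is a Lévy measure. Let $L'$ be its Lévy seed, a random variable with $\mathbb{E}\,e^{i\theta L'}=e^{\psi(\theta)}$. Assume that $L'$ is not almost surely zero, $\mathbb{E}(L')=0$ and $\mathbb{E}(L'^4)<\infty$, and put $\kappa_2=\mathbb{E}(L'^2)$, $\eta=\mathbb{E}(L'^4)/\kappa_2^2$. Let $f:\mathbb{R}\times\mathbb{R}\to\mathbb{R}$ be such that the stochastic integrals (in the sense of Rajput and Rosiński) $$Y_t=\int_{\mathbb{R}\times\mathbb{R}}f(x,t-s)\,L(dx,ds),\qquad t\in\mathbb{R},$$ exist (a mixed moving average process), and let $\gamma(h)=\mathrm{Cov}(Y_0,Y_h)$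 for $h\in\mathbb{R}$. Let $\Delta>0$ and assume that $f\in L^2(\mathbb{R}\times\mathbb{R})\cap L^4(\mathbb{R}\times\mathbb{R})$, that the function $(x,u)\mapsto\sum_{j\in\mathbb{Z}}f^2(x,u+j\Delta)$ is in $L^2(\mathbb{R}\times[0,\Delta])$, and that $\sum_{j\in\mathbb{Z}}|\gamma(\Delta j)|^2<\infty$. For $q\in\mathbb{Z}$ put $$G_{q;\Delta}(x,u)=\sum_{j\in\mathbb{Z}}f(x,u+j\Delta)f(x,u+(j+q)\Delta),\qquad (x,u)\in\mathbb{R}\times[0,\Delta],$$ and for integers $n\ge1$, $h\ge0$ put $\widehat\gamma^*_{n;\Delta}(\Delta h)=n^{-1}\sum_{j=1}^nY_{j\Delta}Y_{(j+h)\Delta}$. Then $G_{q;\Delta}\in L^2(\mathbb{R}\times[0,\Delta])$ for every $q\in\mathbb{Z}$. Moreover, for all integers $p,q\ge0$, the variables $\widehat\gamma^*_{n;\Delta}(\Delta p)$ and $\widehat\gamma^*_{n;\Delta}(\Delta q)$ are square-integrable for every $n\ge1$, the series below converges absolutely, and $$\lim_{n\to\infty}n\,\mathrm{Cov}\bigl(\widehat\gamma^*_{n;\Delta}(\Delta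 p),\widehat\gamma^*_{n;\Delta}(\Delta q)\bigr)=v_{pq;\Delta},$$ $$v_{pq;\Delta}=(\eta-3)\kappa_2^2\int_{\mathbb{R}\times[0,\Delta]}G_{p;\Delta}(x,u)G_{q;\Delta}(x,u)\,dx\,du+\sum_{l\in\mathbb{Z}}\bigl[\gamma(l\Delta)\gamma((l+p-q)\Delta)+\gamma((l-q)\Delta)\gamma((l+p)\Delta)\bigr].$$ -/

import Mathlib

open MeasureTheory ProbabilityTheory Filter Topology

noncomputable section

/-- Lévy measure on `ℝ`: no mass at the origin and `∫ min(1, ξ²) ν(dξ) < ∞`. -/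
structure IsLevyMeasure (ν : Measure ℝ) : Prop where
  zero_mass : ν {0} = 0
  lintegral_lt_top : ∫⁻ ξ, ENNReal.ofReal (min 1 (ξ ^ 2)) ∂ν < ⊤

/-- The Lévy–Khintchine exponent (cumulant function)
`iθζ - θ²a/2 + ∫ (e^{iθξ} - 1 - iθξ 1_{[-1,1]}(ξ)) ν(dξ)` of a triplet `(ζ, a, ν)`. -/
def levyExponent (ζ a : ℝ) (ν : Measure ℝ) (θ : ℝ) : ℂ :=
  Complex.I * θ * ζ - (1 / 2) * θ ^ 2 * a
    + ∫ ξ : ℝ, (Complex.exp (Complex.I * θ * ξ) - 1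
        - Complex.I * θ * ((Set.Icc (-1 : ℝ) 1).indicator id ξ : ℝ)) ∂ν

/-- Infinite divisibility of a law `m` on `ℝ`: for every `k ≥ 1`, `m` is the law of a sum of `k`
i.i.d. random variables. -/
def IsInfinitelyDivisible (m : Measure ℝ) : Prop :=
  ∀ k : ℕ, 1 ≤ k → ∃ r : Measure ℝ, IsProbabilityMeasure r ∧
    m = (Measure.pi (fun _ : Fin k => r)).map (fun x => ∑ i, x i)

/-- Bounded Borel subsets of `ℝ × ℝ`. -/
def IsBoundedBorel (A : Set (ℝ × ℝ)) : Prop :=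
  MeasurableSet A ∧ Bornology.IsBounded A

variable {Ω : Type*} [MeasurableSpace Ω]

/-- A real-valued Lévy basis `L = {L(A) : A bounded Borel}` on `ℝ × ℝ`; the values of `L` at other
sets are irrelevant. The series in `countably_additive` converges almost surely in the order of the
sequence (absolute convergence would exclude Gaussian bases). -/
structure IsLevyBasis (P : Measure Ω) (L : Set (ℝ × ℝ) → Ω → ℝ) : Prop where
  measurable : ∀ A, IsBoundedBorel A → Measurable (L A)
  countably_additive : ∀ A : ℕ → Set (ℝ × ℝ), (∀ j, IsBoundedBorel (A j)) →
    Pairwise (Function.onFun Disjoint A) → IsBoundedBorel (⋃ j, A j) →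
    ∀ᵐ ω ∂P, Tendsto (fun n : ℕ => ∑ j ∈ Finset.range n, L (A j) ω) atTop
      (𝓝 (L (⋃ j, A j) ω))
  indep : ∀ A : ℕ → Set (ℝ × ℝ), (∀ j, IsBoundedBorel (A j)) →
    Pairwise (Function.onFun Disjoint A) → iIndepFun (fun j => L (A j)) P
  infinitely_divisible : ∀ A, IsBoundedBorel A → IsInfinitelyDivisible (P.map (L A))

/-- A homogeneous Lévy basis with characteristic triplet `(ζ, a, ν)`: the cumulant function of
`L(A)` is `Leb(A)` times the Lévy–Khintchine exponent of the triplet. -/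
structure IsHomogeneousLevyBasis (P : Measure Ω) (L : Set (ℝ × ℝ) → Ω → ℝ)
    (ζ a : ℝ) (ν : Measure ℝ) : Prop extends IsLevyBasis P L where
  gaussian_nonneg : 0 ≤ a
  levyMeasure : IsLevyMeasure ν
  charFun_eq : ∀ A, IsBoundedBorel A → ∀ θ : ℝ,
    charFun (P.map (L A)) θ = Complex.exp ((volume A).toReal * levyExponent ζ a ν θ)

/-- A Lévy seed of the triplet `(ζ, a, ν)`: a random variable whose cumulant function is the
Lévy–Khintchine exponent of the triplet. -/
structure IsLevySeed (P : Measure Ω) (L' : Ω → ℝ) (ζ a : ℝ) (ν : Measure ℝ) : Prop where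
  measurable : Measurable L'
  charFun_eq : ∀ θ : ℝ, charFun (P.map L') θ = Complex.exp (levyExponent ζ a ν θ)

/-- The integral `∫_A φ dL = ∑_{r ≠ 0} r L(A ∩ {φ = r})` of a simple function `φ` with bounded
support. -/
def simpleLevyIntegral (L : Set (ℝ × ℝ) → Ω → ℝ) (φ : SimpleFunc (ℝ × ℝ) ℝ)
    (A : Set (ℝ × ℝ)) (ω : Ω) : ℝ :=
  ∑ r ∈ φ.range.filter (fun r => r ≠ 0), r * L (A ∩ φ ⁻¹' {r}) ω

/-- `X` is (a version of) the stochastic integral `∫ g dL` over `ℝ × ℝ` in the sense of Rajput and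
Rosiński: there are simple functions `φ n` with bounded support converging to `g` almost everywhere
such that `∫_A φ n dL` converges in probability for every Borel set `A`, and `X` is the limit for
`A = ℝ × ℝ`. -/
def IsLevyIntegral (P : Measure Ω) (L : Set (ℝ × ℝ) → Ω → ℝ) (g : ℝ × ℝ → ℝ) (X : Ω → ℝ) :
    Prop :=
  ∃ φ : ℕ → SimpleFunc (ℝ × ℝ) ℝ,
    (∀ n, Bornology.IsBounded (Function.support (φ n))) ∧
    (∀ᵐ z, Tendsto (fun n => φ n z) atTop (𝓝 (g z))) ∧
    (∀ A, MeasurableSet A → ∃ Z : Ω → ℝ,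
      TendstoInMeasure P (fun n => simpleLevyIntegral L (φ n) A) atTop Z) ∧
    TendstoInMeasure P (fun n => simpleLevyIntegral L (φ n) Set.univ) atTop X

/-- `Y` is the mixed moving average process `Y_t = ∫ f(x, t - s) L(dx, ds)`, `t ∈ ℝ`. -/
def IsMMAP (P : Measure Ω) (L : Set (ℝ × ℝ) → Ω → ℝ) (f : ℝ × ℝ → ℝ) (Y : ℝ → Ω → ℝ) : Prop :=
  ∀ t : ℝ, IsLevyIntegral P L (fun z => f (z.1, t - z.2)) (Y t)

/-- The autocovariance function `γ(h) = Cov(Y_0, Y_h)`. -/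
def autocov (P : Measure Ω) (Y : ℝ → Ω → ℝ) (h : ℝ) : ℝ :=
  cov[Y 0, Y h; P]

/-- The sample autocovariance `γ̂*_{n;Δ}(Δh) = n⁻¹ ∑_{j=1}^n Y_{jΔ} Y_{(j+h)Δ}`. -/
def sampleAutocov (Y : ℝ → Ω → ℝ) (Δ : ℝ) (n h : ℕ) (ω : Ω) : ℝ :=
  (n : ℝ)⁻¹ * ∑ j ∈ Finset.Icc 1 n, Y ((j : ℝ) * Δ) ω * Y (((j : ℝ) + (h : ℝ)) * Δ) ω

/-- `G_{q;Δ}(x, u) = ∑_{j ∈ ℤ} f(x, u + jΔ) f(x, u + (j+q)Δ)`. -/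
def periodizedProduct (f : ℝ × ℝ → ℝ) (Δ : ℝ) (q : ℤ) (z : ℝ × ℝ) : ℝ :=
  ∑' j : ℤ, f (z.1, z.2 + (j : ℝ) * Δ) * f (z.1, z.2 + ((j : ℝ) + (q : ℝ)) * Δ)

/-- Lebesgue measure on the strip `ℝ × [0, Δ]`. -/
def stripVolume (Δ : ℝ) : Measure (ℝ × ℝ) :=
  volume.restrict (Set.univ ×ˢ Set.Icc 0 Δ)

/-- The `l`-th term `γ(lΔ)γ((l+p-q)Δ) + γ((l-q)Δ)γ((l+p)Δ)` of the Bartlett sum. -/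
def bartlettTerm (γ : ℝ → ℝ) (Δ : ℝ) (p q : ℕ) (l : ℤ) : ℝ :=
  γ ((l : ℝ) * Δ) * γ (((l : ℝ) + p - q) * Δ) + γ (((l : ℝ) - q) * Δ) * γ (((l : ℝ) + p) * Δ)

end

/-! The theorem rests on a fourth-moment formula for the stochastic integral. If `X₁, …, X₄` are
integrals of `g₁, …, g₄ ∈ L² ∩ L⁴`, then `E X₁X₂X₃X₄` is `κ₄ ∫ g₁g₂g₃g₄` plus the three Gaussian
pairings of `κ₂ ∫ gᵢgⱼ`, where `κ₄ = E L'⁴ - 3κ₂² = (η - 3)κ₂²` is the fourth cumulant of the seed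
(`integral_mul_mul_mul_of_isFourthOrderIntegral`). Consequently the covariance of `Y_{jΔ}Y_{(j+p)Δ}`
and `Y_{kΔ}Y_{(k+q)Δ}` depends on `l = k - j` only: it is `κ₄` times an integral of four shifts of
`f`, plus two products of autocovariances. `n` times the covariance of the sample autocovariances is
`n⁻¹` times the double sum over `j, k`, that is, a Cesàro mean of symmetric partial sums over `l`,
and converges to the full sum (`tendsto_cesaro_sum_sub`). The pairings give the Bartlett series. The
integrals of four shifts, unfolded into strips of width `Δ`, add up to `∫ G_p G_q`
(`hasSum_integral_mul_mul_mul`); square integrability of `∑ f²` over the strip provides the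
domination.

The fourth-moment formula starts from the second and fourth cumulants of `L(A)`, which are `κ₂
Leb(A)` and `κ₄ Leb(A)`. They are read off from the relation `G'F = tF'G` near `0` between the
characteristic functions `F` of the seed and `G = e^{tψ}` of `L(A)`, `t = Leb(A)`, so the exponent
need only be continuous at `0`. Independence carries the formula to simple functions, `L⁴(P)`-limits
to `L² ∩ L⁴`, and polarization to four different integrands.

One gap remains: the Rajput–Rosiński integral is defined by some approximating sequence that
converges almost everywhere, not in `L²`. A gliding hump argument (`exists_gliding_hump`) shows that
convergence in probability over every Borel set forces its limit to agree with the `L⁴(P)`-limit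
along a well-chosen sequence. -/

/-! ### Moments of a law with characteristic function `e^{tψ}`. -/

/-- The integrand of the Lévy–Khintchine exponent is dominated by `2 min(1, ξ²)` for `|θ| ≤ 1`. -/
lemma norm_levyKhintchine_integrand_le {θ : ℝ} (hθ : |θ| ≤ 1) (ξ : ℝ) :
    ‖Complex.exp (Complex.I * θ * ξ) - 1
        - Complex.I * θ * ((Set.Icc (-1 : ℝ) 1).indicator id ξ : ℝ)‖ ≤ 2 * min 1 (ξ ^ 2) := by
  by_cases hξ : ξ ∈ Set.Icc (-1 : ℝ) 1
  · have hξ1 : |ξ| ≤ 1 := abs_le.2 hξ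
    have hn : ‖Complex.I * θ * (ξ : ℂ)‖ = |θ| * |ξ| := by simp
    have h1 : ‖Complex.I * θ * (ξ : ℂ)‖ ≤ 1 := by
      rw [hn]; exact mul_le_one₀ hθ (abs_nonneg _) hξ1
    have h2 := Complex.norm_exp_sub_one_sub_id_le h1
    rw [Set.indicator_of_mem hξ, id]
    refine h2.trans ?_
    rw [hn, mul_pow, sq_abs, sq_abs]
    have h3 : ξ ^ 2 ≤ 1 := by rw [← sq_abs]; exact pow_le_one₀ (abs_nonneg _) hξ1
    have h4 : θ ^ 2 ≤ 1 := by rw [← sq_abs]; exact pow_le_one₀ (abs_nonneg _) hθ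
    rw [min_eq_right h3]
    nlinarith [sq_nonneg ξ]
  · have h1 : 1 ≤ ξ ^ 2 := by
      rw [Set.mem_Icc, not_and_or, not_le, not_le] at hξ
      rcases hξ with h | h <;> nlinarith
    rw [Set.indicator_of_notMem hξ, min_eq_left h1]
    have h2 : ‖Complex.exp (Complex.I * θ * (ξ : ℂ))‖ = 1 := by
      rw [mul_assoc, ← Complex.ofReal_mul, mul_comm, Complex.norm_exp_ofReal_mul_I]
    calc _ ≤ ‖Complex.exp (Complex.I * θ * (ξ : ℂ))‖ + ‖(1 : ℂ)‖ := by
            simpa using norm_sub_le (Complex.exp (Complex.I * θ * (ξ : ℂ))) 1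
      _ = 2 * 1 := by rw [h2]; norm_num

lemma levyExponent_zero (ζ a : ℝ) (ν : Measure ℝ) : levyExponent ζ a ν 0 = 0 := by
  simp [levyExponent]

lemma IsLevyMeasure.integrable_min {ν : Measure ℝ} (hν : IsLevyMeasure ν) :
    Integrable (fun ξ : ℝ => min 1 (ξ ^ 2)) ν := by
  refine ⟨by fun_prop, ?_⟩
  rw [hasFiniteIntegral_iff_ofReal (ae_of_all _ fun ξ => by positivity)]
  exact hν.lintegral_lt_top

/-- Dominated convergence on `|θ| ≤ 1`. Continuity at `0` is the only regularity of the exponent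
that is used: it makes the exponent a branch of the logarithm of the characteristic function near
`0`. -/
lemma continuousAt_levyExponent_zero (ζ a : ℝ) {ν : Measure ℝ} (hν : IsLevyMeasure ν) :
    ContinuousAt (levyExponent ζ a ν) 0 := by
  unfold levyExponent
  refine ContinuousAt.add (by fun_prop) ?_
  refine continuousAt_of_dominated (bound := fun ξ => 2 * min 1 (ξ ^ 2)) ?_ ?_
    (hν.integrable_min.const_mul 2) ?_
  · refine Eventually.of_forall fun θ => Measurable.aestronglyMeasurable ?_
    have : Measurable (fun ξ : ℝ => (Set.Icc (-1 : ℝ) 1).indicator id ξ) :=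
      measurable_id.indicator measurableSet_Icc
    fun_prop
  · have : ∀ᶠ θ : ℝ in 𝓝 0, |θ| ≤ 1 := by
      filter_upwards [Metric.closedBall_mem_nhds (0 : ℝ) one_pos] with θ hθ
      simpa using hθ
    filter_upwards [this] with θ hθ
    exact ae_of_all _ fun ξ => norm_levyKhintchine_integrand_le hθ ξ
  · exact ae_of_all _ fun ξ => by fun_prop

/-- If `charFun μ = e^ψ` and `charFun ρ = e^{tψ}` with `ψ` continuous at `0`, then
`(charFun ρ)' charFun μ = t (charFun μ)' charFun ρ` near `0`. -/
lemma charFun_deriv_mul_eventuallyEq {μ ρ : Measure ℝ} [IsProbabilityMeasure μ]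
    [IsProbabilityMeasure ρ] {ψ : ℝ → ℂ} (hψ : ContinuousAt ψ 0) (hψ0 : ψ 0 = 0) {t : ℝ}
    (hμ : ∀ θ, charFun μ θ = Complex.exp (ψ θ)) (hρ : ∀ θ, charFun ρ θ = Complex.exp (t * ψ θ))
    (hd : Differentiable ℝ (charFun μ)) :
    (deriv (charFun ρ)) * (charFun μ) =ᶠ[𝓝 0] (t : ℂ) • (deriv (charFun μ) * charFun ρ) := by
  have hlt : ∀ᶠ θ in 𝓝 (0 : ℝ), ‖ψ θ‖ < 1 := by
    have := hψ.norm
    rw [ContinuousAt, hψ0, norm_zero] at this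
    exact this.eventually (gt_mem_nhds one_pos)
  have hpi := Real.pi_gt_three
  -- Where `|Im ψ| < 1 < π`, the principal logarithm inverts `exp`, so `ψ = log (charFun μ)`
  -- inherits differentiability from the characteristic function.
  have hlog : ∀ᶠ θ in 𝓝 (0 : ℝ), ψ θ = Complex.log (charFun μ θ) ∧
      charFun μ θ ∈ Complex.slitPlane := by
    filter_upwards [hlt] with θ hθ
    have him : |(ψ θ).im| < 1 := (Complex.abs_im_le_norm _).trans_lt hθ
    rw [abs_lt] at him
    have hl : Complex.log (charFun μ θ) = ψ θ := by
      rw [hμ]; exact Complex.log_exp (by linarith) (by linarith)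
    refine ⟨hl.symm, ?_⟩
    rw [Complex.mem_slitPlane_iff_arg]
    refine ⟨?_, by rw [hμ]; exact Complex.exp_ne_zero _⟩
    rw [← Complex.log_im, hl]
    linarith
  filter_upwards [hlog.eventually_nhds] with θ hθ
  have hs := hθ.self_of_nhds.2
  have hne : charFun μ θ ≠ 0 := by rw [hμ]; exact Complex.exp_ne_zero _
  have hF : HasDerivAt (charFun μ) (deriv (charFun μ) θ) θ := (hd θ).hasDerivAt
  have hG : HasDerivAt (charFun ρ)
      (Complex.exp (t * Complex.log (charFun μ θ)) *
        (t * (deriv (charFun μ) θ / charFun μ θ))) θ := by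
    have h1 : HasDerivAt (fun θ => Complex.exp (t * Complex.log (charFun μ θ))) _ θ :=
      ((hF.clog_real hs).const_mul (t : ℂ)).cexp
    refine h1.congr_of_eventuallyEq ?_
    filter_upwards [hθ] with θ' h'
    rw [hρ, ← h'.1]
  simp only [Pi.mul_apply, Pi.smul_apply, smul_eq_mul]
  rw [hG.deriv, hρ, ← hθ.self_of_nhds.1]
  field_simp

/-- Moments of a law with characteristic function `e^{tψ}` in terms of those of the law with
characteristic function `e^ψ`. -/
lemma moments_of_charFun_eq_exp {μ ρ : Measure ℝ} [IsProbabilityMeasure μ]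
    [IsProbabilityMeasure ρ] {ψ : ℝ → ℂ} (hψ : ContinuousAt ψ 0) (hψ0 : ψ 0 = 0) {t : ℝ}
    (hμ : ∀ θ, charFun μ θ = Complex.exp (ψ θ)) (hρ : ∀ θ, charFun ρ θ = Complex.exp (t * ψ θ))
    (hμ4 : MemLp id 4 μ) (hρ4 : MemLp id 4 ρ) (hmean : ∫ x, x ∂μ = 0) :
    ∫ x, x ∂ρ = 0 ∧ ∫ x, x ^ 2 ∂ρ = t * ∫ x, x ^ 2 ∂μ ∧
      ∫ x, x ^ 4 ∂ρ = t * (∫ x, x ^ 4 ∂μ - 3 * (∫ x, x ^ 2 ∂μ) ^ 2)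
        + 3 * (t * ∫ x, x ^ 2 ∂μ) ^ 2 := by
  have hF4 : ContDiff ℝ 4 (charFun μ) := contDiff_charFun (n := 4) hμ4
  have hG4 : ContDiff ℝ 4 (charFun ρ) := contDiff_charFun (n := 4) hρ4
  have hF3 : ContDiff ℝ 3 (deriv (charFun μ)) := hF4.deriv' (n := 3)
  have hG3 : ContDiff ℝ 3 (deriv (charFun ρ)) := hG4.deriv' (n := 3)
  have key := charFun_deriv_mul_eventuallyEq hψ hψ0 hμ hρ (hF4.differentiable (by norm_num))
  -- The `k`-th derivative at `0` of `G'F = tF'G`, by Leibniz. The orders `k = 0, 1, 3` yield the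
  -- first, second and fourth moments of `ρ`; third moments drop out at `k = 3` because both means
  -- vanish.
  have hk : ∀ k : ℕ, k ≤ 3 →
      ∑ i ∈ Finset.range (k + 1), (k.choose i : ℂ) * iteratedDeriv (i + 1) (charFun ρ) 0
          * iteratedDeriv (k - i) (charFun μ) 0
        = t * ∑ i ∈ Finset.range (k + 1), (k.choose i : ℂ) * iteratedDeriv (i + 1) (charFun μ) 0
          * iteratedDeriv (k - i) (charFun ρ) 0 := by
    intro k hk
    have hk3 : (k : WithTop ℕ∞) ≤ 3 := by exact_mod_cast hk
    have hk4 : (k : WithTop ℕ∞) ≤ 4 := by exact_mod_cast hk.trans (by norm_num)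
    have := key.iteratedDeriv_eq k
    rw [iteratedDeriv_mul (hG3.of_le hk3).contDiffAt (hF4.of_le hk4).contDiffAt,
      iteratedDeriv_const_smul_field,
      iteratedDeriv_mul (hF3.of_le hk3).contDiffAt (hG4.of_le hk4).contDiffAt] at this
    simpa only [iteratedDeriv_succ', smul_eq_mul] using this
  have hm : ∀ (m : Measure ℝ) [IsProbabilityMeasure m], MemLp id 4 m → ∀ k : ℕ, k ≤ 4 →
      iteratedDeriv k (charFun m) 0 = Complex.I ^ k * ((∫ x, x ^ k ∂m : ℝ) : ℂ) := by
    intro m _ h4 k hk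
    exact iteratedDeriv_charFun_zero (h4.mono_exponent (by exact_mod_cast hk))
  have hI2 : Complex.I ^ 2 = -1 := Complex.I_sq
  have hI3 : Complex.I ^ 3 = -Complex.I := by rw [pow_succ, hI2]; ring
  have hI4 : Complex.I ^ 4 = 1 := by rw [pow_succ, hI3]; simp
  have e0 := hk 0 (by norm_num)
  have e1 := hk 1 (by norm_num)
  have e2 := hk 2 (by norm_num)
  have e3 := hk 3 (by norm_num)
  simp only [Finset.sum_range_succ, Finset.sum_range_zero, zero_add, Nat.choose_self,
    Nat.choose_zero_right, Nat.choose_one_right, Nat.cast_one, one_mul, Nat.sub_self, Nat.sub_zero,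
    show Nat.choose 3 2 = 3 from rfl, show (2 : ℕ) - 1 = 1 from rfl, show (3 : ℕ) - 1 = 2 from rfl,
    show (3 : ℕ) + 1 = 4 from rfl] at e0 e1 e2 e3
  rw [hm ρ hρ4 1 (by norm_num), hm μ hμ4 1 (by norm_num), hm ρ hρ4 0 (by norm_num),
    hm μ hμ4 0 (by norm_num)] at e0 e1 e2 e3
  rw [hm ρ hρ4 2 (by norm_num), hm μ hμ4 2 (by norm_num)] at e1 e2 e3
  rw [hm ρ hρ4 3 (by norm_num), hm μ hμ4 3 (by norm_num)] at e2 e3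
  rw [hm ρ hρ4 4 (by norm_num), hm μ hμ4 4 (by norm_num)] at e3
  simp only [hI2, hI3, hI4, pow_zero, pow_one, integral_const, probReal_univ, smul_eq_mul,
    Complex.ofReal_one, mul_one, one_mul, hmean, Complex.ofReal_zero, mul_zero] at e0 e1 e2 e3
  have m1 : ∫ x, x ∂ρ = 0 := by
    have := (mul_eq_zero.1 e0).resolve_left Complex.I_ne_zero
    exact_mod_cast this
  rw [m1] at e1 e2 e3
  have m2 : ∫ x, x ^ 2 ∂ρ = t * ∫ x, x ^ 2 ∂μ := by
    have : ((∫ x, x ^ 2 ∂ρ : ℝ) : ℂ) = ((t * ∫ x, x ^ 2 ∂μ : ℝ) : ℂ) := by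
      push_cast; linear_combination -e1
    exact_mod_cast this
  refine ⟨m1, m2, ?_⟩
  have : ((∫ x, x ^ 4 ∂ρ : ℝ) : ℂ) = ((t * (∫ x, x ^ 4 ∂μ - 3 * (∫ x, x ^ 2 ∂μ) ^ 2)
        + 3 * (t * ∫ x, x ^ 2 ∂μ) ^ 2 : ℝ) : ℂ) := by
    rw [m2] at e3
    push_cast at e3 ⊢
    linear_combination e3
  exact_mod_cast this

/-! ### Integrability of convolution powers and of independent summands. -/

/-- A power `(charFun μ) ^ k` is the characteristic function of a law with as many moments. -/
lemma exists_charFun_eq_pow {μ : Measure ℝ} [IsProbabilityMeasure μ] {p : ENNReal}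
    (hμ : MemLp id p μ) (k : ℕ) :
    ∃ ρ : Measure ℝ, IsProbabilityMeasure ρ ∧ MemLp id p ρ ∧
      ∀ θ, charFun ρ θ = charFun μ θ ^ k := by
  induction k with
  | zero =>
    refine ⟨Measure.dirac 0, inferInstance, ?_, fun θ => by simp [charFun_apply]⟩
    refine (memLp_congr_ae ?_).2 (MemLp.zero' (p := p))
    rw [Filter.EventuallyEq, ae_dirac_iff (measurableSet_eq_fun measurable_id measurable_const)]
    rfl
  | succ k ih =>
    obtain ⟨ρ, hρ, hρp, hch⟩ := ih
    refine ⟨ρ ∗ μ, inferInstance, ?_, fun θ => by rw [charFun_conv, hch, pow_succ]⟩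
    rw [Measure.conv, memLp_map_measure_iff (by fun_prop) (by fun_prop)]
    exact (hρp.comp_fst μ).add (hμ.comp_snd ρ)

/-- If the sum of two independent variables is in `L^p`, so is each summand. -/
lemma MemLp.of_add_of_indepFun {Ω : Type*} [MeasurableSpace Ω] {P : Measure Ω}
    [IsProbabilityMeasure P] {X Y : Ω → ℝ} {p : ENNReal} (hp0 : p ≠ 0) (hp : p ≠ ⊤)
    (hX : Measurable X) (hY : Measurable Y)
    (hXY : IndepFun X Y P) (h : MemLp (fun ω => X ω + Y ω) p P) : MemLp X p P := by
  have hprod := (indepFun_iff_map_prod_eq_prod_map_map hX.aemeasurable hY.aemeasurable).1 hXY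
  have : IsProbabilityMeasure (P.map X) := Measure.isProbabilityMeasure_map hX.aemeasurable
  have : IsProbabilityMeasure (P.map Y) := Measure.isProbabilityMeasure_map hY.aemeasurable
  have h1 : MemLp (fun z : ℝ × ℝ => z.1 + z.2) p ((P.map X).prod (P.map Y)) := by
    rw [← hprod, memLp_map_measure_iff (by fun_prop) (by fun_prop)]
    exact h
  have h2 := (integrable_norm_rpow_iff (by fun_prop) hp0 hp).2 h1
  -- By Fubini `x ↦ x + y` is in `L^p` of the law of `X` for almost every `y`. One such `y`
  -- suffices, constants being in `L^p`.
  obtain ⟨y, hy⟩ := h2.prod_left_ae.exists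
  have h3 : MemLp (fun x : ℝ => x + y) p (P.map X) :=
    (integrable_norm_rpow_iff (by fun_prop) hp0 hp).1 hy
  have h4 : MemLp (id : ℝ → ℝ) p (P.map X) := by
    have := h3.sub (memLp_const y)
    refine (memLp_congr_ae (ae_of_all _ fun x => ?_)).1 this
    simp
  rw [memLp_map_measure_iff (by fun_prop) hX.aemeasurable] at h4
  exact h4

/-! ### Cumulants of a homogeneous Lévy basis. -/

/-- A finitely additive, independently scattered, centred random measure on the bounded Borel sets
whose second and fourth cumulants are `κ₂ Leb` and `κ₄ Leb`. -/
structure IsFourthOrderRandomMeasure {Ω : Type*} [MeasurableSpace Ω] (P : Measure Ω)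
    (L : Set (ℝ × ℝ) → Ω → ℝ) (κ₂ κ₄ : ℝ) : Prop where
  measurable : ∀ A, IsBoundedBorel A → Measurable (L A)
  memLp : ∀ A, IsBoundedBorel A → MemLp (L A) 4 P
  mean : ∀ A, IsBoundedBorel A → ∫ ω, L A ω ∂P = 0
  second : ∀ A, IsBoundedBorel A → ∫ ω, L A ω ^ 2 ∂P = κ₂ * volume.real A
  fourth : ∀ A, IsBoundedBorel A →
    ∫ ω, L A ω ^ 4 ∂P = κ₄ * volume.real A + 3 * (κ₂ * volume.real A) ^ 2
  add : ∀ A B, IsBoundedBorel A → IsBoundedBorel B → Disjoint A B →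
    L (A ∪ B) =ᵐ[P] fun ω => L A ω + L B ω
  indep : ∀ A : ℕ → Set (ℝ × ℝ), (∀ j, IsBoundedBorel (A j)) →
    Pairwise (Function.onFun Disjoint A) → iIndepFun (fun j => L (A j)) P

section

variable {Ω : Type*} [MeasurableSpace Ω] {P : Measure Ω} {L : Set (ℝ × ℝ) → Ω → ℝ}

lemma isBoundedBorel_empty : IsBoundedBorel ∅ := ⟨.empty, Bornology.isBounded_empty⟩

lemma IsBoundedBorel.union {A B : Set (ℝ × ℝ)} (hA : IsBoundedBorel A) (hB : IsBoundedBorel B) :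
    IsBoundedBorel (A ∪ B) := ⟨hA.1.union hB.1, hA.2.union hB.2⟩

lemma IsBoundedBorel.subset {A B : Set (ℝ × ℝ)} (hB : IsBoundedBorel B) (hA : MeasurableSet A)
    (h : A ⊆ B) : IsBoundedBorel A := ⟨hA, hB.2.subset h⟩

/-- For the constant sequence `∅` the partial sums `n L(∅)` converge almost surely, so their
increments `L(∅)` tend to `0`. -/
lemma IsLevyBasis.empty (hL : IsLevyBasis P L) : L ∅ =ᵐ[P] 0 := by
  have h := hL.countably_additive (fun _ => ∅) (fun _ => isBoundedBorel_empty)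
    (fun _ _ _ => by simp [Function.onFun]) (by simpa using isBoundedBorel_empty)
  filter_upwards [h] with ω hω
  simp only [Set.iUnion_empty, Finset.sum_const, Finset.card_range, nsmul_eq_mul] at hω
  have h1 := hω.comp (tendsto_add_atTop_nat 1)
  have h2 := h1.sub hω
  simp only [Function.comp_def, sub_self] at h2
  have h3 : (fun n : ℕ => ((n + 1 : ℕ) : ℝ) * L ∅ ω - n * L ∅ ω) = fun _ => L ∅ ω := by
    funext n; push_cast; ring
  rw [h3] at h2
  exact tendsto_nhds_unique tendsto_const_nhds h2

/-- The sequence `A, B, ∅, ∅, …`. -/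
def pairSeq (A B : Set (ℝ × ℝ)) : ℕ → Set (ℝ × ℝ)
  | 0 => A
  | 1 => B
  | _ + 2 => ∅

lemma pairwise_disjoint_pairSeq {A B : Set (ℝ × ℝ)} (h : Disjoint A B) :
    Pairwise (Function.onFun Disjoint (pairSeq A B)) := by
  intro i j hij
  rcases i with _ | _ | i <;> rcases j with _ | _ | j <;>
    simp_all [Function.onFun, pairSeq, h.symm]

lemma isBoundedBorel_pairSeq {A B : Set (ℝ × ℝ)} (hA : IsBoundedBorel A) (hB : IsBoundedBorel B)
    (j : ℕ) : IsBoundedBorel (pairSeq A B j) := by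
  rcases j with _ | _ | j
  · exact hA
  · exact hB
  · exact isBoundedBorel_empty

lemma iUnion_pairSeq (A B : Set (ℝ × ℝ)) : ⋃ j, pairSeq A B j = A ∪ B := by
  ext z
  simp only [Set.mem_iUnion, Set.mem_union]
  constructor
  · rintro ⟨_ | _ | j, h⟩
    · exact .inl h
    · exact .inr h
    · exact h.elim
  · rintro (h | h)
    · exact ⟨0, h⟩
    · exact ⟨1, h⟩

lemma IsLevyBasis.union (hL : IsLevyBasis P L) {A B : Set (ℝ × ℝ)} (hA : IsBoundedBorel A)
    (hB : IsBoundedBorel B) (hAB : Disjoint A B) :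
    L (A ∪ B) =ᵐ[P] fun ω => L A ω + L B ω := by
  have h := hL.countably_additive (pairSeq A B) (isBoundedBorel_pairSeq hA hB)
    (pairwise_disjoint_pairSeq hAB) (by rw [iUnion_pairSeq]; exact hA.union hB)
  rw [iUnion_pairSeq] at h
  filter_upwards [h, hL.empty] with ω hω h0
  have h1 := hω.comp (tendsto_add_atTop_nat 2)
  refine tendsto_nhds_unique h1 (tendsto_const_nhds.congr fun n => ?_)
  simp only [Function.comp_def]
  rw [Finset.sum_range_succ', Finset.sum_range_succ']
  simp [pairSeq, h0, add_comm]

lemma IsLevyBasis.indepFun (hL : IsLevyBasis P L) {A B : Set (ℝ × ℝ)} (hA : IsBoundedBorel A)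
    (hB : IsBoundedBorel B) (hAB : Disjoint A B) : IndepFun (L A) (L B) P :=
  (hL.indep (pairSeq A B) (isBoundedBorel_pairSeq hA hB)
    (pairwise_disjoint_pairSeq hAB)).indepFun (i := 0) (j := 1) (by norm_num)

/-- A bounded Borel set lies in one of integer Lebesgue measure. -/
lemma IsBoundedBorel.exists_superset_volume_eq_natCast {A : Set (ℝ × ℝ)} (hA : IsBoundedBorel A) :
    ∃ (B : Set (ℝ × ℝ)) (k : ℕ), IsBoundedBorel B ∧ A ⊆ B ∧ (volume B).toReal = k := by
  obtain ⟨R, hR⟩ := hA.2.subset_closedBall (0 : ℝ × ℝ)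
  obtain ⟨n, hn⟩ := exists_nat_ge R
  -- A square of integer half-side. Integer area makes the law of `L(B)` a convolution power of the
  -- law of the seed.
  refine ⟨Set.Icc (-(n : ℝ)) n ×ˢ Set.Icc (-(n : ℝ)) n, (2 * n) * (2 * n),
    ⟨measurableSet_Icc.prod measurableSet_Icc,
      (Metric.isBounded_Icc _ _).prod (Metric.isBounded_Icc _ _)⟩, ?_, ?_⟩
  · intro z hz
    have h1 := hR hz
    rw [mem_closedBall_zero_iff, Prod.norm_def, max_le_iff, Real.norm_eq_abs, Real.norm_eq_abs,
      abs_le, abs_le] at h1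
    exact ⟨⟨by linarith, by linarith⟩, ⟨by linarith, by linarith⟩⟩
  · rw [Measure.volume_eq_prod, Measure.prod_prod, Real.volume_Icc, ENNReal.toReal_mul,
      ENNReal.toReal_ofReal (by simp)]
    push_cast
    ring

/-- Everything about the Lévy basis that the sequel needs; the characteristic triplet plays no role
afterwards. -/
theorem IsHomogeneousLevyBasis.isFourthOrderRandomMeasure [IsProbabilityMeasure P]
    {ζ a : ℝ} {ν : Measure ℝ} (hL : IsHomogeneousLevyBasis P L ζ a ν)
    {Ω' : Type*} [MeasurableSpace Ω'] {P' : Measure Ω'} [IsProbabilityMeasure P']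
    {L' : Ω' → ℝ} (hL' : IsLevySeed P' L' ζ a ν) (hmean : ∫ ω, L' ω ∂P' = 0)
    (hfourth : MemLp L' 4 P') :
    IsFourthOrderRandomMeasure P L (∫ ω, L' ω ^ 2 ∂P')
      (∫ ω, L' ω ^ 4 ∂P' - 3 * (∫ ω, L' ω ^ 2 ∂P') ^ 2) := by
  have hm := hL'.measurable
  have hprob' : IsProbabilityMeasure (P'.map L') :=
    Measure.isProbabilityMeasure_map hm.aemeasurable
  have hμ4 : MemLp id 4 (P'.map L') := by
    rw [memLp_map_measure_iff (by fun_prop) hm.aemeasurable]; exact hfourth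
  have hprob : ∀ A, IsBoundedBorel A → IsProbabilityMeasure (P.map (L A)) := fun A hA =>
    Measure.isProbabilityMeasure_map (hL.measurable A hA).aemeasurable
  -- The moment formulas presuppose a finite fourth moment. It is clear for a superset `B` of
  -- integer area and passes to `A` because `L(B) = L(A) + L(B \ A)` with independent summands.
  have hmem : ∀ A, IsBoundedBorel A → MemLp (L A) 4 P := by
    intro A hA
    obtain ⟨B, k, hB, hAB, hk⟩ := hA.exists_superset_volume_eq_natCast
    have hBp := hprob B hB
    have hLB : MemLp (L B) 4 P := by
      obtain ⟨ρ, hρ, hρ4, hch⟩ := exists_charFun_eq_pow hμ4 k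
      have : P.map (L B) = ρ := by
        refine Measure.ext_of_charFun (funext fun θ => ?_)
        rw [hL.charFun_eq B hB, hch, hL'.charFun_eq, hk, ← Complex.exp_nat_mul]
        simp
      rw [← this, memLp_map_measure_iff (by fun_prop) (hL.measurable B hB).aemeasurable] at hρ4
      exact hρ4
    have hBA : IsBoundedBorel (B \ A) := hB.subset (hB.1.diff hA.1) Set.sdiff_subset
    have hu := hL.toIsLevyBasis.union hA hBA Set.disjoint_sdiff_right
    rw [Set.union_sdiff_cancel hAB] at hu
    exact MemLp.of_add_of_indepFun (by norm_num) (by norm_num) (hL.measurable A hA)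
      (hL.measurable _ hBA) (hL.toIsLevyBasis.indepFun hA hBA Set.disjoint_sdiff_right)
      ((memLp_congr_ae hu).1 hLB)
  have hmom : ∀ A, IsBoundedBorel A → ∫ ω, L A ω ∂P = 0 ∧
      ∫ ω, L A ω ^ 2 ∂P = volume.real A * ∫ ω, L' ω ^ 2 ∂P' ∧
      ∫ ω, L A ω ^ 4 ∂P
        = volume.real A * (∫ ω, L' ω ^ 4 ∂P' - 3 * (∫ ω, L' ω ^ 2 ∂P') ^ 2)
          + 3 * (volume.real A * ∫ ω, L' ω ^ 2 ∂P') ^ 2 := by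
    intro A hA
    have hAp := hprob A hA
    have hLA := (hL.measurable A hA).aemeasurable (μ := P)
    have hρ4 : MemLp id 4 (P.map (L A)) := by
      rw [memLp_map_measure_iff (by fun_prop) hLA]; exact hmem A hA
    have hmean' : ∫ x, x ∂(P'.map L') = 0 := by
      rw [integral_map hm.aemeasurable (by fun_prop), hmean]
    have := moments_of_charFun_eq_exp (continuousAt_levyExponent_zero ζ a hL.levyMeasure)
      (levyExponent_zero ζ a ν) hL'.charFun_eq (hL.charFun_eq A hA) hμ4 hρ4 hmean'
    rwa [integral_map hLA (by fun_prop), integral_map hLA (by fun_prop),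
      integral_map hLA (by fun_prop), integral_map hm.aemeasurable (by fun_prop),
      integral_map hm.aemeasurable (by fun_prop)] at this
  exact
    { measurable := hL.measurable
      memLp := hmem
      mean := fun A hA => (hmom A hA).1
      second := fun A hA => by rw [(hmom A hA).2.1, mul_comm]
      fourth := fun A hA => by
        rw [(hmom A hA).2.2, mul_comm (volume.real A), mul_comm (volume.real A)]
      add := fun A B hA hB hAB => hL.toIsLevyBasis.union hA hB hAB
      indep := hL.indep }

/-- Second and fourth moments of a sum of two independent centred variables. -/
lemma ProbabilityTheory.IndepFun.moments_add [IsProbabilityMeasure P] {X Y : Ω → ℝ}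
    (hXY : IndepFun X Y P) (hX : MemLp X 4 P) (hY : MemLp Y 4 P) (hX0 : ∫ ω, X ω ∂P = 0) (hY0 : ∫ ω, Y ω ∂P = 0) :
    ∫ ω, (X ω + Y ω) ^ 2 ∂P = ∫ ω, X ω ^ 2 ∂P + ∫ ω, Y ω ^ 2 ∂P ∧
    ∫ ω, (X ω + Y ω) ^ 4 ∂P = ∫ ω, X ω ^ 4 ∂P
      + 6 * (∫ ω, X ω ^ 2 ∂P) * (∫ ω, Y ω ^ 2 ∂P) + ∫ ω, Y ω ^ 4 ∂P := by
  have hpow : ∀ {Z : Ω → ℝ}, MemLp Z 4 P → ∀ k : ℕ, k ≤ 4 → Integrable (fun ω => Z ω ^ k) P := by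
    intro Z hZ k hk
    have h1 : MemLp Z k P := hZ.mono_exponent (by exact_mod_cast hk)
    refine (integrable_norm_iff (hZ.1.pow k)).1 ?_
    simpa [norm_pow] using h1.integrable_norm_pow'
  have hind : ∀ i j : ℕ, IndepFun (fun ω => X ω ^ i) (fun ω => Y ω ^ j) P := fun i j =>
    hXY.comp (φ := fun x => x ^ i) (ψ := fun x => x ^ j) (by fun_prop) (by fun_prop)
  have hmul : ∀ i j : ℕ, i ≤ 4 → j ≤ 4 → Integrable (fun ω => X ω ^ i * Y ω ^ j) P :=
    fun i j hi hj => (hind i j).integrable_mul (hpow hX i hi) (hpow hY j hj)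
  have hint : ∀ i j : ℕ, ∫ ω, X ω ^ i * Y ω ^ j ∂P
      = (∫ ω, X ω ^ i ∂P) * ∫ ω, Y ω ^ j ∂P := fun i j =>
    (hind i j).integral_fun_mul_eq_mul_integral (hX.1.pow i) (hY.1.pow j)
  constructor
  · have : ∀ ω, (X ω + Y ω) ^ 2 = X ω ^ 2 + 2 * (X ω ^ 1 * Y ω ^ 1) + Y ω ^ 2 := fun ω => by ring
    simp_rw [this]
    rw [integral_add ((hpow hX 2 (by norm_num)).fun_add
        ((hmul 1 1 (by norm_num) (by norm_num)).const_mul _))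
      (hpow hY 2 (by norm_num)), integral_add (hpow hX 2 (by norm_num))
      ((hmul 1 1 (by norm_num) (by norm_num)).const_mul _), integral_const_mul, hint]
    simp [hX0]
  · have : ∀ ω, (X ω + Y ω) ^ 4 = X ω ^ 4 + 4 * (X ω ^ 3 * Y ω ^ 1) + 6 * (X ω ^ 2 * Y ω ^ 2)
        + 4 * (X ω ^ 1 * Y ω ^ 3) + Y ω ^ 4 := fun ω => by ring
    simp_rw [this]
    have i4 := hpow hX 4 (by norm_num)
    have i31 := (hmul 3 1 (by norm_num) (by norm_num)).const_mul 4
    have i22 := (hmul 2 2 (by norm_num) (by norm_num)).const_mul 6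
    have i13 := (hmul 1 3 (by norm_num) (by norm_num)).const_mul 4
    rw [integral_add (((i4.fun_add i31).fun_add i22).fun_add i13) (hpow hY 4 (by norm_num)),
      integral_add ((i4.fun_add i31).fun_add i22) i13, integral_add (i4.fun_add i31) i22,
      integral_add i4 i31, integral_const_mul, integral_const_mul, integral_const_mul,
      hint, hint, hint]
    simp only [pow_one, hX0, hY0]
    ring

/-- Second and fourth moments of a finite sum of independent centred variables. -/
lemma ProbabilityTheory.iIndepFun.moments_sum [IsProbabilityMeasure P] {ι : Type*} {X : ι → Ω → ℝ}
    (hm : ∀ i, Measurable (X i)) (hind : iIndepFun X P) (h4 : ∀ i, MemLp (X i) 4 P)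
    (h0 : ∀ i, ∫ ω, X i ω ∂P = 0) (s : Finset ι) :
    ∫ ω, (∑ i ∈ s, X i ω) ^ 2 ∂P = ∑ i ∈ s, ∫ ω, X i ω ^ 2 ∂P ∧
    ∫ ω, (∑ i ∈ s, X i ω) ^ 4 ∂P
      = ∑ i ∈ s, (∫ ω, X i ω ^ 4 ∂P - 3 * (∫ ω, X i ω ^ 2 ∂P) ^ 2)
        + 3 * (∑ i ∈ s, ∫ ω, X i ω ^ 2 ∂P) ^ 2 := by
  classical
  induction s using Finset.induction_on with
  | empty => simp
  | insert i s hi ih =>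
    have hI : IndepFun (X i) (fun ω => ∑ j ∈ s, X j ω) P := by
      have := (hind.indepFun_finsetSum_of_notMem hm hi).symm
      convert this using 1
      ext ω; simp
    have hS : MemLp (fun ω => ∑ j ∈ s, X j ω) 4 P := memLp_finsetSum s fun j _ => h4 j
    have hS0 : ∫ ω, ∑ j ∈ s, X j ω ∂P = 0 := by
      rw [integral_finsetSum s fun j _ => (h4 j).integrable (by norm_num)]
      exact Finset.sum_eq_zero fun j _ => h0 j
    -- The cross term `6 E X² E Y²` is the one in `3 (E X² + E Y²)²`, so the fourth cumulant `E X⁴ -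
    -- 3 (E X²)²` is additive.
    obtain ⟨e2, e4⟩ := hI.moments_add (h4 i) hS (h0 i) hS0
    simp only [Finset.sum_insert hi]
    rw [e2, e4, ih.1, ih.2]
    exact ⟨rfl, by ring⟩

end

/-! ### Integrals of simple functions: moments and linearity. -/

section

variable {Ω : Type*} [MeasurableSpace Ω] {P : Measure Ω} {L : Set (ℝ × ℝ) → Ω → ℝ} {κ₂ κ₄ : ℝ}

namespace IsFourthOrderRandomMeasure

/-- Independence is postulated for sequences only. The index set is embedded in `ℕ` and the family
is extended by `∅`, which is disjoint from every set, itself included. -/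
lemma iIndepFun_of_countable (h : IsFourthOrderRandomMeasure P L κ₂ κ₄) {ι : Type*} [Countable ι]
    {A : ι → Set (ℝ × ℝ)} (hA : ∀ i, IsBoundedBorel (A i))
    (hd : Pairwise (Function.onFun Disjoint A)) : iIndepFun (fun i => L (A i)) P := by
  obtain ⟨g, hg⟩ := Countable.exists_injective_nat ι
  have hcases : ∀ j, (∃ i, g i = j ∧ Function.extend g A (fun _ => ∅) j = A i) ∨
      Function.extend g A (fun _ => ∅) j = ∅ := by
    intro j
    by_cases hj : ∃ i, g i = j
    · obtain ⟨i, rfl⟩ := hj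
      exact .inl ⟨i, rfl, hg.extend_apply _ _ _⟩
    · exact .inr (Function.extend_apply' _ _ _ hj)
  have := (h.indep (Function.extend g A fun _ => ∅) ?_ ?_).precomp hg
  · simpa only [hg.extend_apply] using this
  · intro j
    rcases hcases j with ⟨i, -, hi⟩ | hj
    · rw [hi]; exact hA i
    · rw [hj]; exact isBoundedBorel_empty
  · intro j k hjk
    rcases hcases j with ⟨i, hij, hi⟩ | hj
    · rcases hcases k with ⟨l, hlk, hl⟩ | hk
      · simp only [Function.onFun, hi, hl]
        exact hd fun hil => hjk (by rw [← hij, ← hlk, hil])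
      · simp [Function.onFun, hk]
    · simp [Function.onFun, hj]

end IsFourthOrderRandomMeasure

lemma IsBoundedBorel.fiber {φ : SimpleFunc (ℝ × ℝ) ℝ}
    (hφ : Bornology.IsBounded (Function.support φ)) {A : Set (ℝ × ℝ)} (hA : MeasurableSet A)
    {r : ℝ} (hr : r ≠ 0) : IsBoundedBorel (A ∩ φ ⁻¹' {r}) := by
  refine ⟨hA.inter (φ.measurableSet_preimage _), hφ.subset ?_⟩
  rintro z ⟨-, hz⟩
  rw [Set.mem_preimage, Set.mem_singleton_iff] at hz
  rw [Function.mem_support, hz]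
  exact hr

lemma setIntegral_simpleFunc_pow {φ : SimpleFunc (ℝ × ℝ) ℝ}
    (hφ : Bornology.IsBounded (Function.support φ)) {A : Set (ℝ × ℝ)} (hA : MeasurableSet A)
    {k : ℕ} (hk : k ≠ 0) :
    ∫ z in A, φ z ^ k = ∑ r ∈ φ.range.filter (fun r => r ≠ 0),
      r ^ k * volume.real (A ∩ φ ⁻¹' {r}) := by
  have hint : Integrable φ (volume.restrict A) := by
    rw [SimpleFunc.integrable_iff]
    intro r hr
    rw [Measure.restrict_apply (φ.measurableSet_preimage _), Set.inter_comm]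
    exact (IsBoundedBorel.fiber hφ hA hr).2.measure_lt_top
  have h1 : ∫ z in A, φ z ^ k = (φ.map (fun r => r ^ k)).integral (volume.restrict A) := by
    rw [SimpleFunc.integral_eq_integral]
    · rfl
    · rw [SimpleFunc.integrable_iff_finMeasSupp] at hint ⊢
      exact hint.map (by simp [hk])
  rw [h1, SimpleFunc.map_integral _ _ hint (by simp [hk]), Finset.sum_filter_of_ne]
  · refine Finset.sum_congr rfl fun r _ => ?_
    rw [smul_eq_mul, mul_comm, measureReal_restrict_apply (φ.measurableSet_preimage _),
      Set.inter_comm]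
  · intro r _ hr0 hr
    simp [hr, hk] at hr0

namespace IsFourthOrderRandomMeasure

lemma memLp_simpleLevyIntegral (h : IsFourthOrderRandomMeasure P L κ₂ κ₄)
    {φ : SimpleFunc (ℝ × ℝ) ℝ} (hφ : Bornology.IsBounded (Function.support φ))
    {A : Set (ℝ × ℝ)} (hA : MeasurableSet A) : MemLp (simpleLevyIntegral L φ A) 4 P := by
  refine memLp_finsetSum _ fun r hr => ?_
  exact (h.memLp _ (IsBoundedBorel.fiber hφ hA (Finset.mem_filter.1 hr).2)).const_mul r

/-- The summands `r L(A ∩ {φ = r})` are independent with cumulants `κ₂ r² Leb` and `κ₄ r⁴ Leb` of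
the fibre; summation over `r` produces the integrals of `φ²` and `φ⁴`. -/
lemma moments_simpleLevyIntegral [IsProbabilityMeasure P]
    (h : IsFourthOrderRandomMeasure P L κ₂ κ₄)
    {φ : SimpleFunc (ℝ × ℝ) ℝ} (hφ : Bornology.IsBounded (Function.support φ))
    {A : Set (ℝ × ℝ)} (hA : MeasurableSet A) :
    ∫ ω, simpleLevyIntegral L φ A ω ∂P = 0 ∧
    ∫ ω, simpleLevyIntegral L φ A ω ^ 2 ∂P = κ₂ * ∫ z in A, φ z ^ 2 ∧
    ∫ ω, simpleLevyIntegral L φ A ω ^ 4 ∂P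
      = κ₄ * (∫ z in A, φ z ^ 4) + 3 * (κ₂ * ∫ z in A, φ z ^ 2) ^ 2 := by
  set R := φ.range.filter (fun r => r ≠ 0) with hR
  have hb : ∀ r : R, IsBoundedBorel (A ∩ φ ⁻¹' {(r : ℝ)}) := fun r =>
    IsBoundedBorel.fiber hφ hA (Finset.mem_filter.1 r.2).2
  have hd : Pairwise (Function.onFun Disjoint fun r : R => A ∩ φ ⁻¹' {(r : ℝ)}) := by
    intro r s hrs
    refine Disjoint.mono Set.inter_subset_right Set.inter_subset_right ?_
    exact Disjoint.preimage _ (Set.disjoint_singleton.2 fun h => hrs (Subtype.ext h))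
  have hind : iIndepFun (fun (r : R) ω => (r : ℝ) * L (A ∩ φ ⁻¹' {(r : ℝ)}) ω) P :=
    (h.iIndepFun_of_countable hb hd).comp (fun r x => (r : ℝ) * x) fun r => by fun_prop
  have hm : ∀ r : R, Measurable (fun ω => (r : ℝ) * L (A ∩ φ ⁻¹' {(r : ℝ)}) ω) := fun r =>
    (h.measurable _ (hb r)).const_mul _
  have h4 : ∀ r : R, MemLp (fun ω => (r : ℝ) * L (A ∩ φ ⁻¹' {(r : ℝ)}) ω) 4 P := fun r =>
    (h.memLp _ (hb r)).const_mul _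
  have h0 : ∀ r : R, ∫ ω, (r : ℝ) * L (A ∩ φ ⁻¹' {(r : ℝ)}) ω ∂P = 0 := fun r => by
    rw [integral_const_mul, h.mean _ (hb r), mul_zero]
  have hs : ∀ ω, simpleLevyIntegral L φ A ω
      = ∑ r : R, (r : ℝ) * L (A ∩ φ ⁻¹' {(r : ℝ)}) ω := fun ω =>
    (Finset.sum_coe_sort R (fun r => r * L (A ∩ φ ⁻¹' {r}) ω)).symm
  obtain ⟨e2, e4⟩ := iIndepFun.moments_sum hm hind h4 h0 Finset.univ
  have hsec : ∀ r : R, ∫ ω, ((r : ℝ) * L (A ∩ φ ⁻¹' {(r : ℝ)}) ω) ^ 2 ∂P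
      = κ₂ * ((r : ℝ) ^ 2 * volume.real (A ∩ φ ⁻¹' {(r : ℝ)})) := fun r => by
    simp_rw [mul_pow]
    rw [integral_const_mul, h.second _ (hb r)]
    ring
  have hfou : ∀ r : R, ∫ ω, ((r : ℝ) * L (A ∩ φ ⁻¹' {(r : ℝ)}) ω) ^ 4 ∂P
      - 3 * (∫ ω, ((r : ℝ) * L (A ∩ φ ⁻¹' {(r : ℝ)}) ω) ^ 2 ∂P) ^ 2
      = κ₄ * ((r : ℝ) ^ 4 * volume.real (A ∩ φ ⁻¹' {(r : ℝ)})) := fun r => by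
    rw [hsec]
    simp_rw [mul_pow]
    rw [integral_const_mul, h.fourth _ (hb r)]
    ring
  have e2' : ∫ ω, simpleLevyIntegral L φ A ω ^ 2 ∂P = κ₂ * ∫ z in A, φ z ^ 2 := by
    simp_rw [hs, e2, hsec]
    rw [← Finset.mul_sum, setIntegral_simpleFunc_pow hφ hA two_ne_zero,
      Finset.sum_coe_sort R (fun r => r ^ 2 * volume.real (A ∩ φ ⁻¹' {r}))]
  refine ⟨?_, e2', ?_⟩
  · simp_rw [hs]
    rw [integral_finsetSum _ fun r _ => (h4 r).integrable (by norm_num)]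
    exact Finset.sum_eq_zero fun r _ => h0 r
  · rw [← e2']
    simp_rw [hs, e4, e2, hfou]
    rw [← Finset.mul_sum, setIntegral_simpleFunc_pow hφ hA four_ne_zero,
      Finset.sum_coe_sort R (fun r => r ^ 4 * volume.real (A ∩ φ ⁻¹' {r}))]

lemma simpleLevyIntegral_add_compl (h : IsFourthOrderRandomMeasure P L κ₂ κ₄)
    {φ : SimpleFunc (ℝ × ℝ) ℝ} (hφ : Bornology.IsBounded (Function.support φ))
    {A : Set (ℝ × ℝ)} (hA : MeasurableSet A) :
    simpleLevyIntegral L φ Set.univ =ᵐ[P]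
      fun ω => simpleLevyIntegral L φ A ω + simpleLevyIntegral L φ Aᶜ ω := by
  have : ∀ r ∈ φ.range.filter (fun r => r ≠ 0), ∀ᵐ ω ∂P, L (Set.univ ∩ φ ⁻¹' {r}) ω
      = L (A ∩ φ ⁻¹' {r}) ω + L (Aᶜ ∩ φ ⁻¹' {r}) ω := by
    intro r hr
    have hr0 := (Finset.mem_filter.1 hr).2
    have := h.add _ _ (IsBoundedBorel.fiber hφ hA hr0) (IsBoundedBorel.fiber hφ hA.compl hr0)
      (disjoint_compl_right.mono Set.inter_subset_left Set.inter_subset_left)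
    rwa [← Set.union_inter_distrib_right, Set.union_compl_self] at this
  filter_upwards [(Finset.eventually_all _).2 this] with ω hω
  simp only [simpleLevyIntegral, ← Finset.sum_add_distrib]
  refine Finset.sum_congr rfl fun r hr => ?_
  rw [hω r hr, mul_add]

open Classical in
/-- The vector measure `S ↦ L(S ∩ C)` with values in `L²(P)`, as used to integrate simple
functions. -/
noncomputable def toLpOn (h : IsFourthOrderRandomMeasure P L κ₂ κ₄) [IsFiniteMeasure P]
    {C : Set (ℝ × ℝ)} (hC : IsBoundedBorel C) (S : Set (ℝ × ℝ)) : ℝ →L[ℝ] Lp ℝ 2 P :=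
  if hS : MeasurableSet S then
    ContinuousLinearMap.toSpanSingleton ℝ
      (((h.memLp (S ∩ C) (hC.subset (hS.inter hC.1) Set.inter_subset_right)).mono_exponent
        (by norm_num : (2 : ENNReal) ≤ 4)).toLp)
  else 0

lemma coeFn_toLpOn (h : IsFourthOrderRandomMeasure P L κ₂ κ₄) [IsFiniteMeasure P]
    {C : Set (ℝ × ℝ)} (hC : IsBoundedBorel C) {S : Set (ℝ × ℝ)} (hS : MeasurableSet S) (r : ℝ) :
    h.toLpOn hC S r =ᵐ[P] fun ω => r * L (S ∩ C) ω := by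
  rw [toLpOn, dif_pos hS, ContinuousLinearMap.toSpanSingleton_apply]
  have hM := (h.memLp (S ∩ C) (hC.subset (hS.inter hC.1) Set.inter_subset_right)).mono_exponent
        (by norm_num : (2 : ENNReal) ≤ 4)
  filter_upwards [Lp.coeFn_smul r hM.toLp, hM.coeFn_toLp] with ω h1 h2
  rw [h1, Pi.smul_apply, h2, smul_eq_mul]

/-- Sets of finite measure may be unbounded, and `L` means nothing there; intersecting with the
bounded set `C` makes additivity available for all of them. -/
lemma finMeasAdditive_toLpOn (h : IsFourthOrderRandomMeasure P L κ₂ κ₄) [IsFiniteMeasure P]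
    {C : Set (ℝ × ℝ)} (hC : IsBoundedBorel C) :
    FinMeasAdditive volume (h.toLpOn hC) := by
  intro S T hS hT _ _ hST
  ext1
  apply Lp.ext
  rw [_root_.add_apply]
  have hadd := h.add (S ∩ C) (T ∩ C) (hC.subset (hS.inter hC.1) Set.inter_subset_right)
    (hC.subset (hT.inter hC.1) Set.inter_subset_right)
    (hST.mono Set.inter_subset_left Set.inter_subset_left)
  filter_upwards [h.coeFn_toLpOn hC (hS.union hT) 1, h.coeFn_toLpOn hC hS 1,
    h.coeFn_toLpOn hC hT 1, Lp.coeFn_add (h.toLpOn hC S 1) (h.toLpOn hC T 1), hadd]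
    with ω h1 h2 h3 h4 h5
  rw [h1, h4, Pi.add_apply, h2, h3, Set.union_inter_distrib_right, h5]
  ring

/-- The nonzero fibres of `φ` lie in `B`, so cutting with `B` changes nothing. Linearity in `φ` then
comes from `SimpleFunc.setToSimpleFunc`, without refining fibres by hand. -/
lemma coeFn_setToSimpleFunc (h : IsFourthOrderRandomMeasure P L κ₂ κ₄) [IsFiniteMeasure P]
    {φ : SimpleFunc (ℝ × ℝ) ℝ} {A B : Set (ℝ × ℝ)} (hB : Function.support φ ⊆ B)
    (hAB : IsBoundedBorel (A ∩ B)) :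
    simpleLevyIntegral L φ A =ᵐ[P] (φ.setToSimpleFunc (h.toLpOn hAB) : Lp ℝ 2 P) := by
  classical
  rw [SimpleFunc.setToSimpleFunc_eq_sum_filter]
  have hsum := Lp.coeFn_finsetSum (φ.range.filter fun x => x ≠ 0)
    (fun x => h.toLpOn hAB (φ ⁻¹' {x}) x)
  have hx : ∀ x ∈ φ.range.filter (fun x => x ≠ 0), ∀ᵐ ω ∂P,
      h.toLpOn hAB (φ ⁻¹' {x}) x ω = x * L (φ ⁻¹' {x} ∩ (A ∩ B)) ω := fun x _ =>
    h.coeFn_toLpOn hAB (φ.measurableSet_preimage _) x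
  filter_upwards [hsum, (Finset.eventually_all _).2 hx] with ω h1 h2
  rw [h1, simpleLevyIntegral, Finset.sum_apply]
  refine Finset.sum_congr rfl fun r hr => ?_
  rw [h2 r hr]
  congr 2
  ext z
  simp only [Set.mem_inter_iff, Set.mem_preimage, Set.mem_singleton_iff]
  constructor
  · rintro ⟨h3, h4⟩
    refine ⟨h4, h3, hB ?_⟩
    rw [Function.mem_support, h4]
    exact (Finset.mem_filter.1 hr).2
  · exact fun h3 => ⟨h3.2.1, h3.1⟩

end IsFourthOrderRandomMeasure

lemma integrable_simpleFunc_of_isBounded_support {φ : SimpleFunc (ℝ × ℝ) ℝ}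
    (hφ : Bornology.IsBounded (Function.support φ)) : Integrable φ volume := by
  rw [SimpleFunc.integrable_iff]
  intro r hr
  have := (IsBoundedBorel.fiber hφ MeasurableSet.univ hr).2.measure_lt_top (μ := volume)
  rwa [Set.univ_inter] at this

namespace IsFourthOrderRandomMeasure

lemma simpleLevyIntegral_add (h : IsFourthOrderRandomMeasure P L κ₂ κ₄) [IsFiniteMeasure P]
    {φ ψ : SimpleFunc (ℝ × ℝ) ℝ} (hφ : Bornology.IsBounded (Function.support φ))
    (hψ : Bornology.IsBounded (Function.support ψ)) {A : Set (ℝ × ℝ)} (hA : MeasurableSet A) :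
    simpleLevyIntegral L (φ + ψ) A =ᵐ[P]
      fun ω => simpleLevyIntegral L φ A ω + simpleLevyIntegral L ψ A ω := by
  obtain ⟨R, hR⟩ := (hφ.union hψ).subset_closedBall 0
  rw [Set.union_subset_iff] at hR
  have hAB : IsBoundedBorel (A ∩ Metric.closedBall 0 R) :=
    ⟨hA.inter measurableSet_closedBall, Metric.isBounded_closedBall.subset Set.inter_subset_right⟩
  have h3 : Function.support (φ + ψ : SimpleFunc (ℝ × ℝ) ℝ) ⊆ Metric.closedBall 0 R := by
    rw [SimpleFunc.coe_add]
    exact (Function.support_add _ _).trans (Set.union_subset hR.1 hR.2)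
  have hadd := SimpleFunc.setToSimpleFunc_add _ (h.finMeasAdditive_toLpOn hAB)
    (integrable_simpleFunc_of_isBounded_support hφ) (integrable_simpleFunc_of_isBounded_support hψ)
  filter_upwards [h.coeFn_setToSimpleFunc hR.1 hAB, h.coeFn_setToSimpleFunc hR.2 hAB,
    h.coeFn_setToSimpleFunc h3 hAB, Lp.coeFn_add (φ.setToSimpleFunc (h.toLpOn hAB))
      (ψ.setToSimpleFunc (h.toLpOn hAB))] with ω e1 e2 e3 e4
  rw [e3, hadd, e4, Pi.add_apply, e1, e2]

lemma simpleLevyIntegral_smul (h : IsFourthOrderRandomMeasure P L κ₂ κ₄) [IsFiniteMeasure P]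
    (c : ℝ) {φ : SimpleFunc (ℝ × ℝ) ℝ} (hφ : Bornology.IsBounded (Function.support φ))
    {A : Set (ℝ × ℝ)} (hA : MeasurableSet A) :
    simpleLevyIntegral L (c • φ) A =ᵐ[P] fun ω => c * simpleLevyIntegral L φ A ω := by
  obtain ⟨R, hR⟩ := hφ.subset_closedBall 0
  have hAB : IsBoundedBorel (A ∩ Metric.closedBall 0 R) :=
    ⟨hA.inter measurableSet_closedBall, Metric.isBounded_closedBall.subset Set.inter_subset_right⟩
  have h3 : Function.support (c • φ : SimpleFunc (ℝ × ℝ) ℝ) ⊆ Metric.closedBall 0 R := by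
    rw [SimpleFunc.coe_smul]
    exact (Function.support_const_smul_subset c φ).trans hR
  have hsmul := SimpleFunc.setToSimpleFunc_smul_real _ (h.finMeasAdditive_toLpOn hAB) c
    (integrable_simpleFunc_of_isBounded_support hφ)
  filter_upwards [h.coeFn_setToSimpleFunc hR hAB, h.coeFn_setToSimpleFunc h3 hAB,
    Lp.coeFn_smul c (φ.setToSimpleFunc (h.toLpOn hAB))] with ω e1 e3 e4
  rw [e3, hsmul, e4, Pi.smul_apply, e1, smul_eq_mul]

lemma simpleLevyIntegral_sub (h : IsFourthOrderRandomMeasure P L κ₂ κ₄) [IsFiniteMeasure P]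
    {φ ψ : SimpleFunc (ℝ × ℝ) ℝ} (hφ : Bornology.IsBounded (Function.support φ))
    (hψ : Bornology.IsBounded (Function.support ψ)) {A : Set (ℝ × ℝ)} (hA : MeasurableSet A) :
    simpleLevyIntegral L (φ - ψ) A =ᵐ[P]
      fun ω => simpleLevyIntegral L φ A ω - simpleLevyIntegral L ψ A ω := by
  have hψ' : Bornology.IsBounded (Function.support ((-1 : ℝ) • ψ : SimpleFunc (ℝ × ℝ) ℝ)) := by
    rw [SimpleFunc.coe_smul]
    exact hψ.subset (Function.support_const_smul_subset _ _)
  have e : φ - ψ = φ + (-1 : ℝ) • ψ := by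
    ext z
    simp [sub_eq_add_neg]
  rw [e]
  filter_upwards [h.simpleLevyIntegral_add hφ hψ' hA, h.simpleLevyIntegral_smul (-1) hψ hA]
    with ω h1 h2
  rw [h1, h2]
  ring

end IsFourthOrderRandomMeasure

end

/-! ### Moments as norms, convergence in probability and the gliding hump. -/

lemma integral_pow_eq_toReal_eLpNorm_pow {α : Type*} [MeasurableSpace α] {μ : Measure α}
    {X : α → ℝ} {k : ℕ} (hk : Even k) (hk0 : k ≠ 0) (hX : MemLp X k μ) :
    ∫ a, X a ^ k ∂μ = (eLpNorm X k μ).toReal ^ k := by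
  rw [hX.eLpNorm_eq_integral_rpow_norm (by exact_mod_cast hk0) (by simp)]
  have h0 : 0 ≤ ∫ a, ‖X a‖ ^ (k : ENNReal).toReal ∂μ := integral_nonneg fun a => by positivity
  rw [ENNReal.toReal_ofReal (by positivity), ENNReal.toReal_natCast,
    Real.rpow_inv_natCast_pow (by simpa using h0) hk0]
  simp [Real.rpow_natCast, hk.pow_abs]

lemma integral_sq_eq_toReal_eLpNorm_sq {α : Type*} [MeasurableSpace α] {μ : Measure α}
    {X : α → ℝ} (hX : MemLp X 2 μ) : ∫ a, X a ^ 2 ∂μ = (eLpNorm X 2 μ).toReal ^ 2 := by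
  have := integral_pow_eq_toReal_eLpNorm_pow (k := 2) (by decide) (by norm_num)
    (by simpa using hX)
  simpa using this

lemma integral_pow_four_eq_toReal_eLpNorm {α : Type*} [MeasurableSpace α] {μ : Measure α}
    {X : α → ℝ} (hX : MemLp X 4 μ) : ∫ a, X a ^ 4 ∂μ = (eLpNorm X 4 μ).toReal ^ 4 := by
  have := integral_pow_eq_toReal_eLpNorm_pow (k := 4) (by decide) (by norm_num)
    (by simpa using hX)
  simpa using this

lemma MeasureTheory.MemLp.integrable_pow_four {α : Type*} [MeasurableSpace α] {μ : Measure α}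
    {X : α → ℝ} (hX : MemLp X 4 μ) : Integrable (fun a => X a ^ 4) μ := by
  refine (integrable_norm_iff (hX.1.pow 4)).1 ?_
  have : MemLp X ((4 : ℕ) : ENNReal) μ := by simpa using hX
  simpa [norm_pow] using this.integrable_norm_pow (by norm_num)

lemma tendsto_eLpNorm_zero_of_tendsto_integral_pow {α : Type*} [MeasurableSpace α]
    {μ : Measure α} {X : ℕ → α → ℝ} {k : ℕ} (hk : Even k) (hk0 : k ≠ 0)
    (hX : ∀ n, MemLp (X n) k μ) (h : Tendsto (fun n => ∫ a, X n a ^ k ∂μ) atTop (𝓝 0)) :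
    Tendsto (fun n => eLpNorm (X n) k μ) atTop (𝓝 0) := by
  simp_rw [fun n => integral_pow_eq_toReal_eLpNorm_pow hk hk0 (hX n)] at h
  have h2 : Tendsto (fun n => (eLpNorm (X n) k μ).toReal) atTop (𝓝 0) := by
    have := h.rpow_const (p := (k : ℝ)⁻¹) (.inr (by positivity))
    rw [Real.zero_rpow (by positivity)] at this
    exact this.congr fun n => Real.pow_rpow_inv_natCast ENNReal.toReal_nonneg hk0
  rw [← ENNReal.tendsto_toReal_iff (fun n => (hX n).2.ne) ENNReal.zero_ne_top]
  simpa using h2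

lemma tendstoInMeasure_zero_of_tendsto_integral_sq {Ω : Type*} [MeasurableSpace Ω]
    {P : Measure Ω} {X : ℕ → Ω → ℝ} (hX : ∀ n, MemLp (X n) 2 P)
    (h : Tendsto (fun n => ∫ ω, X n ω ^ 2 ∂P) atTop (𝓝 0)) :
    TendstoInMeasure P X atTop 0 := by
  refine tendstoInMeasure_of_tendsto_eLpNorm (p := 2) (by norm_num) (fun n => (hX n).1)
    aestronglyMeasurable_zero ?_
  simpa using tendsto_eLpNorm_zero_of_tendsto_integral_pow (k := 2) (by decide) (by norm_num)
    (by simpa using hX) h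

lemma MeasureTheory.TendstoInMeasure.sub {Ω ι E : Type*} [MeasurableSpace Ω]
    [SeminormedAddCommGroup E] {P : Measure Ω} {l : Filter ι} {X Y : ι → Ω → E} {X' Y' : Ω → E}
    (hX : TendstoInMeasure P X l X') (hY : TendstoInMeasure P Y l Y') :
    TendstoInMeasure P (fun n ω => X n ω - Y n ω) l (fun ω => X' ω - Y' ω) := by
  rw [tendstoInMeasure_iff_norm] at hX hY ⊢
  intro ε hε
  have h := (hX (ε / 2) (half_pos hε)).add (hY (ε / 2) (half_pos hε))
  rw [add_zero] at h
  refine tendsto_of_tendsto_of_tendsto_of_le_of_le tendsto_const_nhds h (fun _ => zero_le)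
    fun n => (measure_mono fun ω hω => ?_).trans (measure_union_le _ _)
  simp only [Set.mem_ofPred_eq, Set.mem_union] at hω ⊢
  by_contra! hcon
  have : X n ω - Y n ω - (X' ω - Y' ω) = (X n ω - X' ω) - (Y n ω - Y' ω) := by abel
  rw [this] at hω
  linarith [norm_sub_le (X n ω - X' ω) (Y n ω - Y' ω)]

lemma setIntegral_le_add_of_subset_union {α : Type*} [MeasurableSpace α] {μ : Measure α}
    {g : α → ℝ} (hg : Integrable g μ) (h0 : ∀ z, 0 ≤ g z) {A S T : Set α} (hA : A ⊆ S ∪ T) :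
    ∫ z in A, g z ∂μ ≤ ∫ z in S, g z ∂μ + ∫ z in T, g z ∂μ := by
  rw [← integral_add_measure hg.integrableOn hg.integrableOn]
  refine integral_mono_measure ((Measure.restrict_mono hA le_rfl).trans
    (Measure.restrict_union_le S T)) (ae_of_all _ h0) ?_
  exact Integrable.add_measure hg.integrableOn hg.integrableOn

/-- Gliding hump: for square-integrable functions converging to `0` almost everywhere there are a
set `A` and a subsequence along which the `L²` mass vanishes alternately on `A` and on `Aᶜ`. -/
lemma exists_gliding_hump {φ : ℕ → ℝ × ℝ → ℝ} (hm : ∀ n, Measurable (φ n))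
    (hi : ∀ n, Integrable (fun z => φ n z ^ 2))
    (h0 : ∀ᵐ z, Tendsto (fun n => φ n z) atTop (𝓝 0)) :
    ∃ A, MeasurableSet A ∧ ∃ n : ℕ → ℕ, Tendsto n atTop atTop ∧
      Tendsto (fun k => ∫ z in A, φ (n (2 * k + 1)) z ^ 2) atTop (𝓝 0) ∧
      Tendsto (fun k => ∫ z in Aᶜ, φ (n (2 * k)) z ^ 2) atTop (𝓝 0) := by
  -- Bounded sets on which all `φ n` are uniformly bounded. They increase to almost the whole plane,
  -- since a convergent sequence is bounded.
  set K : ℕ → Set (ℝ × ℝ) := fun m => {z | ∀ n, |φ n z| ≤ m} ∩ Metric.closedBall 0 m with hK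
  have hKm : ∀ m, MeasurableSet (K m) := fun m => by
    refine MeasurableSet.inter ?_ measurableSet_closedBall
    rw [Set.ofPred_forall]
    exact MeasurableSet.iInter fun n => measurableSet_le (hm n).abs measurable_const
  have hKmono : Monotone K := fun m m' hmm z hz => by
    have hmm' : (m : ℝ) ≤ m' := by exact_mod_cast hmm
    exact ⟨fun n => (hz.1 n).trans hmm', Metric.closedBall_subset_closedBall hmm' hz.2⟩
  have hKae : ∀ᵐ z, ∃ m₀, ∀ m ≥ m₀, z ∈ K m := by
    filter_upwards [h0] with z hz
    obtain ⟨c, hc⟩ := hz.abs.bddAbove_range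
    obtain ⟨m₀, hm₀⟩ := exists_nat_ge (max c ‖z‖)
    refine ⟨m₀, fun m hmm => hKmono hmm ⟨fun n => ?_, ?_⟩⟩
    · exact (hc ⟨n, rfl⟩).trans ((le_max_left _ _).trans hm₀)
    · rw [mem_closedBall_zero_iff]
      exact (le_max_right _ _).trans hm₀
  have f1 : ∀ m, Tendsto (fun n => ∫ z in K m, φ n z ^ 2) atTop (𝓝 0) := fun m => by
    have hfin : volume (K m) < ⊤ :=
      (Metric.isBounded_closedBall.subset Set.inter_subset_right).measure_lt_top
    rw [← integral_zero (ℝ × ℝ) ℝ (μ := volume.restrict (K m))]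
    refine tendsto_integral_of_dominated_convergence (fun _ => (m : ℝ) ^ 2)
      (fun n => ((hm n).pow_const 2).aestronglyMeasurable)
      (integrableOn_const hfin.ne) (fun n => ?_) ?_
    · refine (ae_restrict_iff' (hKm m)).2 (ae_of_all _ fun z hz => ?_)
      rw [Real.norm_of_nonneg (sq_nonneg _), ← sq_abs]
      exact pow_le_pow_left₀ (abs_nonneg _) (hz.1 n) 2
    · filter_upwards [ae_restrict_of_ae h0] with z hz
      simpa using hz.pow 2
  have f2 : ∀ n, Tendsto (fun m => ∫ z in (K m)ᶜ, φ n z ^ 2) atTop (𝓝 0) := fun n => by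
    rw [funext fun m => (integral_indicator (f := fun z => φ n z ^ 2) (hKm m).compl).symm,
      ← integral_zero (ℝ × ℝ) ℝ (μ := volume)]
    refine tendsto_integral_of_dominated_convergence (fun z => φ n z ^ 2)
      (fun m => (((hm n).pow_const 2).indicator (hKm m).compl).aestronglyMeasurable)
      (hi n) (fun m => ae_of_all _ fun z => ?_) ?_
    · refine (norm_indicator_le_norm_self _ _).trans ?_
      rw [Real.norm_of_nonneg (sq_nonneg _)]
    · filter_upwards [hKae] with z ⟨m₀, hz⟩
      refine tendsto_const_nhds.congr' ?_
      filter_upwards [eventually_ge_atTop m₀] with m hmm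
      rw [Set.indicator_of_notMem (by simpa using hz m hmm)]
  -- First `n` is taken so large that `φ n` has little mass on `K m`, then `m'` so large that it has
  -- little outside `K m'`: the mass sits in the shell `K m' \ K m`.
  have step : ∀ k m : ℕ, ∃ n m', k ≤ n ∧ m ≤ m' ∧
      ∫ z in K m, φ n z ^ 2 < 1 / ((k : ℝ) + 1) ∧
      ∫ z in (K m')ᶜ, φ n z ^ 2 < 1 / ((k : ℝ) + 1) := by
    intro k m
    have hpos : (0 : ℝ) < 1 / ((k : ℝ) + 1) := by positivity
    obtain ⟨n, hn1, hn2⟩ :=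
      ((eventually_ge_atTop k).and ((f1 m).eventually (gt_mem_nhds hpos))).exists
    obtain ⟨m', hm1, hm2⟩ :=
      ((eventually_ge_atTop m).and ((f2 n).eventually (gt_mem_nhds hpos))).exists
    exact ⟨n, m', hn1, hm1, hn2, hm2⟩
  choose N M hN hM hN2 hM2 using step
  obtain ⟨m, hmsucc⟩ : ∃ m : ℕ → ℕ, ∀ k, m (k + 1) = M k (m k) :=
    ⟨fun k => Nat.rec 0 (fun k mk => M k mk) k, fun _ => rfl⟩
  have hmmono : Monotone m := monotone_nat_of_le_succ fun k => by rw [hmsucc]; exact hM _ _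
  set n : ℕ → ℕ := fun k => N k (m k) with hndef
  have hn : Tendsto n atTop atTop := tendsto_atTop_mono (fun k => hN k (m k)) tendsto_id
  have hlim : Tendsto (fun k : ℕ => 2 * (1 / ((k : ℝ) + 1))) atTop (𝓝 0) := by
    simpa using (tendsto_one_div_add_atTop_nhds_zero_nat (𝕜 := ℝ)).const_mul 2
  have hbound : ∀ (k : ℕ) (B : Set (ℝ × ℝ)), B ⊆ K (m k) ∪ (K (m (k + 1)))ᶜ →
      ∫ z in B, φ (n k) z ^ 2 ≤ 2 * (1 / ((k : ℝ) + 1)) := fun k B hB => by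
    refine (setIntegral_le_add_of_subset_union (hi _) (fun z => sq_nonneg _) hB).trans ?_
    have h1 := hN2 k (m k)
    have h2 := hM2 k (m k)
    rw [← hmsucc] at h2
    simp only [hndef]
    linarith
  -- `A` is the union of the even-numbered shells: it misses the shells carrying `φ (n k)` for odd
  -- `k`, and its complement misses those for even `k`.
  refine ⟨⋃ j, K (m (2 * j + 1)) \ K (m (2 * j)),
    MeasurableSet.iUnion fun j => (hKm _).diff (hKm _), n, hn, ?_, ?_⟩
  · refine squeeze_zero (fun k => integral_nonneg fun z => sq_nonneg _)
      (fun k => hbound (2 * k + 1) _ ?_)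
      (hlim.comp (tendsto_atTop_mono (fun k => (by omega : k ≤ 2 * k + 1)) tendsto_id))
    intro z hz
    obtain ⟨j, hj1, hj2⟩ := Set.mem_iUnion.1 hz
    rcases Nat.lt_or_ge k j with hkj | hkj
    · right
      exact fun hz' => hj2 (hKmono (hmmono (by omega : 2 * k + 1 + 1 ≤ 2 * j)) hz')
    · left
      exact hKmono (hmmono (by omega : 2 * j + 1 ≤ 2 * k + 1)) hj1
  · refine squeeze_zero (fun k => integral_nonneg fun z => sq_nonneg _)
      (fun k => hbound (2 * k) _ ?_)
      (hlim.comp (tendsto_atTop_mono (fun k => (by omega : k ≤ 2 * k)) tendsto_id))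
    intro z hz
    by_contra hcon
    rw [Set.mem_union, not_or, Set.notMem_compl_iff] at hcon
    exact hz (Set.mem_iUnion.2 ⟨k, hcon.2, hcon.1⟩)

section

variable {Ω : Type*} [MeasurableSpace Ω] {P : Measure Ω} {L : Set (ℝ × ℝ) → Ω → ℝ} {κ₂ κ₄ : ℝ}

namespace IsFourthOrderRandomMeasure

lemma memLp_two_simpleLevyIntegral (h : IsFourthOrderRandomMeasure P L κ₂ κ₄) [IsFiniteMeasure P]
    {φ : SimpleFunc (ℝ × ℝ) ℝ} (hφ : Bornology.IsBounded (Function.support φ))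
    {A : Set (ℝ × ℝ)} (hA : MeasurableSet A) : MemLp (simpleLevyIntegral L φ A) 2 P :=
  (h.memLp_simpleLevyIntegral hφ hA).mono_exponent (by norm_num)

/-- The second moment of the integral over `A` is `κ₂ ∫_A φ²`, so vanishing `L²` mass on `A`
identifies the limit in probability over `A` as `0`. -/
lemma tendstoInMeasure_simpleLevyIntegral_zero (h : IsFourthOrderRandomMeasure P L κ₂ κ₄)
    [IsProbabilityMeasure P] {φ : ℕ → SimpleFunc (ℝ × ℝ) ℝ}
    (hφ : ∀ n, Bornology.IsBounded (Function.support (φ n))) {A : Set (ℝ × ℝ)}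
    (hA : MeasurableSet A) (hlim : Tendsto (fun n => ∫ z in A, φ n z ^ 2) atTop (𝓝 0)) :
    TendstoInMeasure P (fun n => simpleLevyIntegral L (φ n) A) atTop 0 := by
  refine tendstoInMeasure_zero_of_tendsto_integral_sq
    (fun n => h.memLp_two_simpleLevyIntegral (hφ n) hA) ?_
  simp_rw [fun n => (h.moments_simpleLevyIntegral (hφ n) hA).2.1]
  simpa using hlim.const_mul κ₂

/-- Simple functions converging to `0` almost everywhere whose integrals over all Borel sets
converge in probability have integrals converging to `0`. -/
theorem ae_eq_zero_of_tendstoInMeasure (h : IsFourthOrderRandomMeasure P L κ₂ κ₄)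
    [IsProbabilityMeasure P] {φ : ℕ → SimpleFunc (ℝ × ℝ) ℝ}
    (hφ : ∀ n, Bornology.IsBounded (Function.support (φ n)))
    (h0 : ∀ᵐ z, Tendsto (fun n => φ n z) atTop (𝓝 0))
    (hA : ∀ A, MeasurableSet A → ∃ Z : Ω → ℝ,
      TendstoInMeasure P (fun n => simpleLevyIntegral L (φ n) A) atTop Z)
    {Z : Ω → ℝ} (hZ : TendstoInMeasure P (fun n => simpleLevyIntegral L (φ n) Set.univ) atTop Z) :
    Z =ᵐ[P] 0 := by
  have hi : ∀ n, Integrable (fun z => φ n z ^ 2) := fun n => by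
    have := (integrable_simpleFunc_of_isBounded_support (hφ n))
    rw [SimpleFunc.integrable_iff_finMeasSupp] at this
    have h2 : Integrable ((φ n).map fun r => r ^ 2) volume := by
      rw [SimpleFunc.integrable_iff_finMeasSupp]
      exact this.map (by simp)
    exact h2
  obtain ⟨A, hAm, n, hn, hodd, heven⟩ :=
    exists_gliding_hump (fun n => (φ n).measurable) hi h0
  obtain ⟨ZA, hZA⟩ := hA A hAm
  have todd : Tendsto (fun k => n (2 * k + 1)) atTop atTop :=
    hn.comp (tendsto_atTop_mono (fun k => (by omega : k ≤ 2 * k + 1)) tendsto_id)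
  have teven : Tendsto (fun k => n (2 * k)) atTop atTop :=
    hn.comp (tendsto_atTop_mono (fun k => (by omega : k ≤ 2 * k)) tendsto_id)
  have h1 : ZA =ᵐ[P] 0 := tendstoInMeasure_ae_unique (hZA.comp todd)
    (h.tendstoInMeasure_simpleLevyIntegral_zero (fun k => hφ _) hAm hodd)
  have hsub : TendstoInMeasure P (fun n => simpleLevyIntegral L (φ n) Aᶜ) atTop
      (fun ω => Z ω - ZA ω) := by
    refine (hZ.sub hZA).congr_left fun n => ?_
    filter_upwards [h.simpleLevyIntegral_add_compl (hφ n) hAm] with ω hω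
    rw [hω]; ring
  have h2 : (fun ω => Z ω - ZA ω) =ᵐ[P] 0 := tendstoInMeasure_ae_unique (hsub.comp teven)
    (h.tendstoInMeasure_simpleLevyIntegral_zero (fun k => hφ _) hAm.compl heven)
  filter_upwards [h1, h2] with ω e1 e2
  simpa [e1] using e2

end IsFourthOrderRandomMeasure

end

/-! ### Approximation in `L² ∩ L⁴` by simple functions. -/

/-- A function in `L^k` for even `k` is the limit in `L^k` of any sequence converging almost
everywhere and dominated by twice its modulus. -/
lemma tendsto_eLpNorm_sub_of_dominated {α : Type*} [MeasurableSpace α] {μ : Measure α}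
    {g : α → ℝ} {u : ℕ → α → ℝ} {k : ℕ} (hk : Even k) (hk0 : k ≠ 0) (hg : MemLp g k μ)
    (hu : ∀ n, AEStronglyMeasurable (u n) μ) (hle : ∀ n, ∀ᵐ a ∂μ, ‖u n a‖ ≤ 2 * ‖g a‖)
    (hlim : ∀ᵐ a ∂μ, Tendsto (fun n => u n a) atTop (𝓝 (g a))) :
    Tendsto (fun n => eLpNorm (fun a => u n a - g a) k μ) atTop (𝓝 0) := by
  have hle3 : ∀ n, ∀ᵐ a ∂μ, ‖u n a - g a‖ ≤ 3 * ‖g a‖ := fun n => by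
    filter_upwards [hle n] with a ha
    linarith [norm_sub_le (u n a) (g a)]
  refine tendsto_eLpNorm_zero_of_tendsto_integral_pow hk hk0
    (fun n => hg.of_le_mul ((hu n).sub hg.1) (hle3 n)) ?_
  rw [← integral_zero α ℝ (μ := μ)]
  refine tendsto_integral_of_dominated_convergence (fun a => (3 : ℝ) ^ k * ‖g a‖ ^ k)
    (fun n => ((hu n).sub hg.1).pow k) ((hg.integrable_norm_pow hk0).const_mul _) (fun n => ?_) ?_
  · filter_upwards [hle3 n] with a ha
    rw [norm_pow, ← mul_pow]
    exact pow_le_pow_left₀ (norm_nonneg _) ha k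
  · filter_upwards [hlim] with a ha
    have := (ha.sub_const (g a)).pow k
    simpa [hk0] using this

/-- Simultaneous approximation in `L²` and `L⁴` by simple functions with bounded support. -/
lemma exists_simpleFunc_tendsto {g : ℝ × ℝ → ℝ} (hg2 : MemLp g 2) (hg4 : MemLp g 4) :
    ∃ ψ : ℕ → SimpleFunc (ℝ × ℝ) ℝ, (∀ n, Bornology.IsBounded (Function.support (ψ n))) ∧
      (∀ᵐ z, Tendsto (fun n => ψ n z) atTop (𝓝 (g z))) ∧
      Tendsto (fun n => eLpNorm (fun z => ψ n z - g z) 2) atTop (𝓝 0) ∧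
      Tendsto (fun n => eLpNorm (fun z => ψ n z - g z) 4) atTop (𝓝 0) := by
  set g' := hg2.1.mk g
  have hg' : Measurable g' := hg2.1.stronglyMeasurable_mk.measurable
  have hgg' : g =ᵐ[volume] g' := hg2.1.ae_eq_mk
  -- Approximation from base point `0` satisfies `‖u n z‖ ≤ 2 ‖g' z‖`, a domination that serves both
  -- exponents at once.
  set u : ℕ → SimpleFunc (ℝ × ℝ) ℝ := fun n =>
    SimpleFunc.approxOn g' hg' Set.univ 0 (Set.mem_univ _) n with hu
  set ψ : ℕ → SimpleFunc (ℝ × ℝ) ℝ := fun n => (u n).restrict (Metric.closedBall 0 n) with hψ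
  have hψv : ∀ n z, ψ n z = (Metric.closedBall (0 : ℝ × ℝ) n).indicator (u n) z := fun n z => by
    simp only [hψ]
    rw [SimpleFunc.restrict_apply _ measurableSet_closedBall]
  have hle : ∀ n, ∀ᵐ z, ‖ψ n z‖ ≤ 2 * ‖g z‖ := fun n => by
    filter_upwards [hgg'] with z hz
    rw [hψv, hz]
    refine (norm_indicator_le_norm_self _ _).trans ?_
    have := SimpleFunc.norm_approxOn_zero_le hg' (Set.mem_univ 0) z n
    linarith
  have hlim : ∀ᵐ z, Tendsto (fun n => ψ n z) atTop (𝓝 (g z)) := by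
    filter_upwards [hgg'] with z hz
    rw [hz]
    have := SimpleFunc.tendsto_approxOn hg' (Set.mem_univ 0) (x := z) (by simp)
    refine this.congr' ?_
    obtain ⟨m, hm⟩ := exists_nat_ge ‖z‖
    filter_upwards [eventually_ge_atTop m] with n hn
    rw [hψv, Set.indicator_of_mem]
    rw [mem_closedBall_zero_iff]
    exact hm.trans (by exact_mod_cast hn)
  have hm : ∀ n, AEStronglyMeasurable (ψ n) volume := fun n => (ψ n).aestronglyMeasurable
  refine ⟨ψ, fun n => ?_, hlim, ?_, ?_⟩
  · refine (Metric.isBounded_closedBall (x := (0 : ℝ × ℝ)) (r := n)).subset fun z hz => ?_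
    by_contra hcon
    exact hz (by rw [hψv, Set.indicator_of_notMem hcon])
  · exact tendsto_eLpNorm_sub_of_dominated (k := 2) (by decide) (by norm_num)
      (by simpa using hg2) hm hle hlim
  · exact tendsto_eLpNorm_sub_of_dominated (k := 4) (by decide) (by norm_num)
      (by simpa using hg4) hm hle hlim

lemma memLp_simpleFunc_of_isBounded_support {φ : SimpleFunc (ℝ × ℝ) ℝ}
    (hφ : Bornology.IsBounded (Function.support φ)) (p : ENNReal) : MemLp φ p := by
  exact SimpleFunc.memLp_of_finite_measure_preimage p
    (SimpleFunc.integrable_iff.1 (integrable_simpleFunc_of_isBounded_support hφ))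

lemma tendsto_toReal_eLpNorm {α : Type*} [MeasurableSpace α] {μ : Measure α} {p : ENNReal}
    [hp : Fact (1 ≤ p)] {u : ℕ → α → ℝ} {v : α → ℝ} (hu : ∀ n, MemLp (u n) p μ) (hv : MemLp v p μ)
    (h : Tendsto (fun n => eLpNorm (fun a => u n a - v a) p μ) atTop (𝓝 0)) :
    Tendsto (fun n => (eLpNorm (u n) p μ).toReal) atTop (𝓝 (eLpNorm v p μ).toReal) := by
  have := ((Lp.tendsto_Lp_iff_tendsto_eLpNorm'' u hu v hv).2 h).norm
  simpa only [Lp.norm_toLp] using this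

lemma tendsto_eLpNorm_add_sub_add {α : Type*} [MeasurableSpace α] {μ : Measure α} {p : ENNReal}
    (hp : 1 ≤ p) {u u' w : ℕ → α → ℝ} {v v' : α → ℝ} (hu : ∀ n, AEStronglyMeasurable (u n) μ)
    (hu' : ∀ n, AEStronglyMeasurable (u' n) μ) (hv : AEStronglyMeasurable v μ)
    (hv' : AEStronglyMeasurable v' μ) (hw : ∀ n, w n =ᵐ[μ] fun a => u n a + u' n a)
    (t : Tendsto (fun n => eLpNorm (fun a => u n a - v a) p μ) atTop (𝓝 0))
    (t' : Tendsto (fun n => eLpNorm (fun a => u' n a - v' a) p μ) atTop (𝓝 0)) :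
    Tendsto (fun n => eLpNorm (fun a => w n a - (v + v') a) p μ) atTop (𝓝 0) := by
  have t2 := t.add t'
  rw [add_zero] at t2
  refine tendsto_of_tendsto_of_tendsto_of_le_of_le tendsto_const_nhds t2 (fun _ => zero_le)
    fun n => ?_
  refine le_trans (le_of_eq (eLpNorm_congr_ae ?_))
    (eLpNorm_add_le ((hu n).sub hv) ((hu' n).sub hv') hp)
  filter_upwards [hw n] with a ha
  simp only [Pi.add_apply, ha]
  ring

lemma tendsto_eLpNorm_smul_sub_smul {α : Type*} [MeasurableSpace α] {μ : Measure α} {p : ENNReal}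
    (c : ℝ) {u w : ℕ → α → ℝ} {v : α → ℝ} (hw : ∀ n, w n =ᵐ[μ] fun a => c * u n a)
    (t : Tendsto (fun n => eLpNorm (fun a => u n a - v a) p μ) atTop (𝓝 0)) :
    Tendsto (fun n => eLpNorm (fun a => w n a - (c • v) a) p μ) atTop (𝓝 0) := by
  have t2 := ENNReal.Tendsto.const_mul (a := ‖c‖ₑ) t (.inr (by simp))
  rw [mul_zero] at t2
  refine t2.congr fun n => ?_
  rw [← eLpNorm_const_smul]
  refine eLpNorm_congr_ae ?_
  filter_upwards [hw n] with a ha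
  simp only [Pi.smul_apply, smul_eq_mul, ha]
  ring

/-! ### Integrals of functions in `L² ∩ L⁴` as `L⁴(P)`-limits. -/

section

variable {Ω : Type*} [MeasurableSpace Ω] {P : Measure Ω} {L : Set (ℝ × ℝ) → Ω → ℝ} {κ₂ κ₄ : ℝ}

/-- `X` is the `L⁴(P)`-limit of integrals of simple functions approximating `g` in `L²` and
`L⁴`. -/
def IsFourthOrderIntegral (P : Measure Ω) (L : Set (ℝ × ℝ) → Ω → ℝ) (g : ℝ × ℝ → ℝ)
    (X : Ω → ℝ) : Prop :=
  MemLp g 2 ∧ MemLp g 4 ∧ MemLp X 4 P ∧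
  ∃ ψ : ℕ → SimpleFunc (ℝ × ℝ) ℝ, (∀ n, Bornology.IsBounded (Function.support (ψ n))) ∧
      Tendsto (fun n => eLpNorm (fun z => ψ n z - g z) 2) atTop (𝓝 0) ∧
      Tendsto (fun n => eLpNorm (fun z => ψ n z - g z) 4) atTop (𝓝 0) ∧
      Tendsto (fun n => eLpNorm (fun ω => simpleLevyIntegral L (ψ n) Set.univ ω - X ω) 4 P) atTop
        (𝓝 0)

namespace IsFourthOrderRandomMeasure

/-- The second and fourth moments are powers of norms, hence continuous under the `L²` and `L⁴`
convergence on both sides; the mean passes to the limit in `L¹(P)`. -/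
theorem moments_of_isFourthOrderIntegral [IsProbabilityMeasure P]
    (h : IsFourthOrderRandomMeasure P L κ₂ κ₄)
    {g : ℝ × ℝ → ℝ} {X : Ω → ℝ} (hX : IsFourthOrderIntegral P L g X) :
    ∫ ω, X ω ∂P = 0 ∧ ∫ ω, X ω ^ 2 ∂P = κ₂ * ∫ z, g z ^ 2 ∧
      ∫ ω, X ω ^ 4 ∂P = κ₄ * (∫ z, g z ^ 4) + 3 * (κ₂ * ∫ z, g z ^ 2) ^ 2 := by
  obtain ⟨hg2, hg4, hX4, ψ, hψ, h2, h4, hI⟩ := hX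
  have : Fact ((1 : ENNReal) ≤ 4) := ⟨by norm_num⟩
  have hX2 : MemLp X 2 P := hX4.mono_exponent (by norm_num)
  have hI4 : ∀ n, MemLp (simpleLevyIntegral L (ψ n) Set.univ) 4 P := fun n =>
    h.memLp_simpleLevyIntegral (hψ n) .univ
  have hI2 : ∀ n, MemLp (simpleLevyIntegral L (ψ n) Set.univ) 2 P := fun n =>
    h.memLp_two_simpleLevyIntegral (hψ n) .univ
  have hmono : ∀ p : ENNReal, p ≤ 4 → Tendsto (fun n =>
      eLpNorm (fun ω => simpleLevyIntegral L (ψ n) Set.univ ω - X ω) p P) atTop (𝓝 0) :=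
    fun p hp => tendsto_of_tendsto_of_tendsto_of_le_of_le tendsto_const_nhds hI
      (fun _ => zero_le) fun n => eLpNorm_le_eLpNorm_of_exponent_le hp ((hI4 n).1.sub hX4.1)
  have hψ2 := fun n => memLp_simpleFunc_of_isBounded_support (hψ n) 2
  have hψ4 := fun n => memLp_simpleFunc_of_isBounded_support (hψ n) 4
  have tψ2 := tendsto_toReal_eLpNorm hψ2 hg2 h2
  have tψ4 := tendsto_toReal_eLpNorm hψ4 hg4 h4
  have tI2 := tendsto_toReal_eLpNorm hI2 hX2 (hmono 2 (by norm_num))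
  have tI4 := tendsto_toReal_eLpNorm hI4 hX4 hI
  have mom := fun n => h.moments_simpleLevyIntegral (hψ n) .univ
  simp only [Measure.restrict_univ] at mom
  refine ⟨?_, ?_, ?_⟩
  · have t1 := tendsto_integral_of_L1' X hX4.1
      (Eventually.of_forall fun n => (hI4 n).integrable (by norm_num)) (hmono 1 (by norm_num))
    simp only [fun n => (mom n).1] at t1
    exact tendsto_nhds_unique t1 tendsto_const_nhds
  · rw [integral_sq_eq_toReal_eLpNorm_sq hX2, integral_sq_eq_toReal_eLpNorm_sq hg2]
    refine tendsto_nhds_unique (tI2.pow 2) (((tψ2.pow 2).const_mul κ₂).congr fun n => ?_)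
    rw [← integral_sq_eq_toReal_eLpNorm_sq (hI2 n), ← integral_sq_eq_toReal_eLpNorm_sq (hψ2 n)]
    exact (mom n).2.1.symm
  · rw [integral_pow_four_eq_toReal_eLpNorm hX4, integral_sq_eq_toReal_eLpNorm_sq hg2,
      integral_pow_four_eq_toReal_eLpNorm hg4]
    refine tendsto_nhds_unique (tI4.pow 4)
      ((((tψ4.pow 4).const_mul κ₄).add ((((tψ2.pow 2).const_mul κ₂).pow 2).const_mul 3)).congr
        fun n => ?_)
    rw [← integral_pow_four_eq_toReal_eLpNorm (hI4 n), ← integral_sq_eq_toReal_eLpNorm_sq (hψ2 n),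
      ← integral_pow_four_eq_toReal_eLpNorm (hψ4 n)]
    exact (mom n).2.2.symm

end IsFourthOrderRandomMeasure

namespace IsFourthOrderIntegral

lemma add [IsProbabilityMeasure P] (h : IsFourthOrderRandomMeasure P L κ₂ κ₄)
    {g g' : ℝ × ℝ → ℝ} {X X' : Ω → ℝ}
    (hX : IsFourthOrderIntegral P L g X) (hX' : IsFourthOrderIntegral P L g' X') :
    IsFourthOrderIntegral P L (g + g') (X + X') := by
  obtain ⟨hg2, hg4, hX4, ψ, hψ, h2, h4, hI⟩ := hX
  obtain ⟨hg2', hg4', hX4', ψ', hψ', h2', h4', hI'⟩ := hX'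
  refine ⟨hg2.add hg2', hg4.add hg4', hX4.add hX4', fun n => ψ n + ψ' n, fun n => ?_, ?_, ?_, ?_⟩
  · rw [SimpleFunc.coe_add]
    exact ((hψ n).union (hψ' n)).subset (Function.support_add _ _)
  · exact tendsto_eLpNorm_add_sub_add (by norm_num) (fun n => (ψ n).aestronglyMeasurable)
      (fun n => (ψ' n).aestronglyMeasurable) hg2.1 hg2'.1 (fun n => ae_of_all _ fun a => rfl) h2 h2'
  · exact tendsto_eLpNorm_add_sub_add (by norm_num) (fun n => (ψ n).aestronglyMeasurable)
      (fun n => (ψ' n).aestronglyMeasurable) hg2.1 hg2'.1 (fun n => ae_of_all _ fun a => rfl) h4 h4'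
  · exact tendsto_eLpNorm_add_sub_add (by norm_num)
      (fun n => (h.memLp_simpleLevyIntegral (hψ n) .univ).1)
      (fun n => (h.memLp_simpleLevyIntegral (hψ' n) .univ).1) hX4.1 hX4'.1
      (fun n => h.simpleLevyIntegral_add (hψ n) (hψ' n) .univ) hI hI'

lemma smul [IsProbabilityMeasure P] (h : IsFourthOrderRandomMeasure P L κ₂ κ₄)
    {g : ℝ × ℝ → ℝ} {X : Ω → ℝ} (c : ℝ) (hX : IsFourthOrderIntegral P L g X) :
    IsFourthOrderIntegral P L (c • g) (c • X) := by
  obtain ⟨hg2, hg4, hX4, ψ, hψ, h2, h4, hI⟩ := hX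
  refine ⟨hg2.const_smul c, hg4.const_smul c, hX4.const_smul c, fun n => c • ψ n, fun n => ?_,
    tendsto_eLpNorm_smul_sub_smul c (fun n => ae_of_all _ fun a => rfl) h2,
    tendsto_eLpNorm_smul_sub_smul c (fun n => ae_of_all _ fun a => rfl) h4,
    tendsto_eLpNorm_smul_sub_smul c (fun n => h.simpleLevyIntegral_smul c (hψ n) .univ) hI⟩
  rw [SimpleFunc.coe_smul]
  exact (hψ n).subset (Function.support_const_smul_subset _ _)

end IsFourthOrderIntegral

namespace IsFourthOrderRandomMeasure

/-- The integrals of a sequence of simple functions that converges in `L²` and in `L⁴` converge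
in `L⁴(P)`. -/
lemma exists_tendsto_eLpNorm [IsProbabilityMeasure P]
    (h : IsFourthOrderRandomMeasure P L κ₂ κ₄) {g : ℝ × ℝ → ℝ} (hg2 : MemLp g 2)
    (hg4 : MemLp g 4) {ψ : ℕ → SimpleFunc (ℝ × ℝ) ℝ}
    (hψ : ∀ n, Bornology.IsBounded (Function.support (ψ n)))
    (h2 : Tendsto (fun n => eLpNorm (fun z => ψ n z - g z) 2) atTop (𝓝 0))
    (h4 : Tendsto (fun n => eLpNorm (fun z => ψ n z - g z) 4) atTop (𝓝 0))
    {A : Set (ℝ × ℝ)} (hA : MeasurableSet A) :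
    ∃ Z : Ω → ℝ, MemLp Z 4 P ∧
      Tendsto (fun n => eLpNorm (fun ω => simpleLevyIntegral L (ψ n) A ω - Z ω) 4 P) atTop
        (𝓝 0) := by
  have : Fact ((1 : ENNReal) ≤ 4) := ⟨by norm_num⟩
  have hψ2 := fun n => memLp_simpleFunc_of_isBounded_support (hψ n) 2
  have hψ4 := fun n => memLp_simpleFunc_of_isBounded_support (hψ n) 4
  have hI4 : ∀ n, MemLp (simpleLevyIntegral L (ψ n) A) 4 P := fun n =>
    h.memLp_simpleLevyIntegral (hψ n) hA
  have t2 := (Lp.tendsto_Lp_iff_tendsto_eLpNorm'' (fun n => ψ n) hψ2 g hg2).2 h2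
  have t4 := (Lp.tendsto_Lp_iff_tendsto_eLpNorm'' (fun n => ψ n) hψ4 g hg4).2 h4
  have d2 := cauchySeq_iff_tendsto_dist_atTop_0.1 t2.cauchySeq
  have d4 := cauchySeq_iff_tendsto_dist_atTop_0.1 t4.cauchySeq
  -- The fourth-moment formula for `ψ m - ψ n`, which shows that the integrals are Cauchy in
  -- `L⁴(P)`. The absolute values are there because the signs of `κ₂` and `κ₄` are not prescribed.
  have hb : ∀ q : ℕ × ℕ, dist ((hI4 q.1).toLp) ((hI4 q.2).toLp) ^ 4
      ≤ |κ₄| * dist ((hψ4 q.1).toLp) ((hψ4 q.2).toLp) ^ 4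
        + 3 * (|κ₂| * dist ((hψ2 q.1).toLp) ((hψ2 q.2).toLp) ^ 2) ^ 2 := by
    intro q
    have hs : Bornology.IsBounded (Function.support (ψ q.1 - ψ q.2 : SimpleFunc (ℝ × ℝ) ℝ)) := by
      rw [SimpleFunc.coe_sub]
      exact ((hψ _).union (hψ _)).subset (Function.support_sub _ _)
    have m := (h.moments_simpleLevyIntegral hs hA).2.2
    have e1 : ∫ ω, simpleLevyIntegral L (ψ q.1 - ψ q.2) A ω ^ 4 ∂P
        = dist ((hI4 q.1).toLp) ((hI4 q.2).toLp) ^ 4 := by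
      rw [dist_eq_norm, ← MemLp.toLp_sub, Lp.norm_toLp,
        ← integral_pow_four_eq_toReal_eLpNorm ((hI4 q.1).sub (hI4 q.2))]
      refine integral_congr_ae ?_
      filter_upwards [h.simpleLevyIntegral_sub (hψ q.1) (hψ q.2) hA] with ω hω
      simp [hω]
    have e2 : ∫ z, (ψ q.1 - ψ q.2 : SimpleFunc (ℝ × ℝ) ℝ) z ^ 2
        = dist ((hψ2 q.1).toLp) ((hψ2 q.2).toLp) ^ 2 := by
      rw [dist_eq_norm, ← MemLp.toLp_sub, Lp.norm_toLp,
        ← integral_sq_eq_toReal_eLpNorm_sq ((hψ2 q.1).sub (hψ2 q.2))]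
      rfl
    have e4 : ∫ z, (ψ q.1 - ψ q.2 : SimpleFunc (ℝ × ℝ) ℝ) z ^ 4
        = dist ((hψ4 q.1).toLp) ((hψ4 q.2).toLp) ^ 4 := by
      rw [dist_eq_norm, ← MemLp.toLp_sub, Lp.norm_toLp,
        ← integral_pow_four_eq_toReal_eLpNorm ((hψ4 q.1).sub (hψ4 q.2))]
      rfl
    rw [← e1, ← e2, ← e4, m]
    have p2 : ∫ z in A, (ψ q.1 - ψ q.2 : SimpleFunc (ℝ × ℝ) ℝ) z ^ 2
        ≤ ∫ z, (ψ q.1 - ψ q.2 : SimpleFunc (ℝ × ℝ) ℝ) z ^ 2 :=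
      setIntegral_le_integral (memLp_simpleFunc_of_isBounded_support hs 2).integrable_sq
        (ae_of_all _ fun z => sq_nonneg _)
    have p4 : ∫ z in A, (ψ q.1 - ψ q.2 : SimpleFunc (ℝ × ℝ) ℝ) z ^ 4
        ≤ ∫ z, (ψ q.1 - ψ q.2 : SimpleFunc (ℝ × ℝ) ℝ) z ^ 4 :=
      setIntegral_le_integral (memLp_simpleFunc_of_isBounded_support hs 4).integrable_pow_four
        (ae_of_all _ fun z => by positivity)
    have n2 : 0 ≤ ∫ z in A, (ψ q.1 - ψ q.2 : SimpleFunc (ℝ × ℝ) ℝ) z ^ 2 :=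
      integral_nonneg fun z => sq_nonneg _
    have n4 : 0 ≤ ∫ z in A, (ψ q.1 - ψ q.2 : SimpleFunc (ℝ × ℝ) ℝ) z ^ 4 :=
      integral_nonneg fun z => by positivity
    refine add_le_add ?_ (mul_le_mul_of_nonneg_left ?_ (by norm_num))
    · exact (mul_le_mul_of_nonneg_right (le_abs_self κ₄) n4).trans
        (mul_le_mul_of_nonneg_left p4 (abs_nonneg _))
    · rw [mul_pow, mul_pow, sq_abs]
      exact mul_le_mul_of_nonneg_left (pow_le_pow_left₀ n2 p2 2) (sq_nonneg _)
  have hc : CauchySeq (fun n => (hI4 n).toLp) := by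
    rw [cauchySeq_iff_tendsto_dist_atTop_0]
    have hr := ((d4.pow 4).const_mul |κ₄|).add ((((d2.pow 2).const_mul |κ₂|).pow 2).const_mul 3)
    have h4' := squeeze_zero (fun q => by positivity) hb (by simpa using hr)
    have := h4'.rpow_const (p := ((4 : ℕ) : ℝ)⁻¹) (.inr (by positivity))
    rw [Real.zero_rpow (by norm_num)] at this
    exact this.congr fun q => Real.pow_rpow_inv_natCast dist_nonneg (by norm_num)
  obtain ⟨Z, hZ⟩ := cauchySeq_tendsto_of_complete hc
  refine ⟨Z, Lp.memLp Z, ?_⟩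
  exact (Lp.tendsto_Lp_iff_tendsto_eLpNorm'' (fun n => simpleLevyIntegral L (ψ n) A) hI4 Z
    (Lp.memLp Z)).1 (by simpa using hZ)

/-- Stochastic integrals of functions in `L² ∩ L⁴` are `L⁴(P)`-limits of simple integrals. -/
theorem isFourthOrderIntegral_of_isLevyIntegral [IsProbabilityMeasure P]
    (h : IsFourthOrderRandomMeasure P L κ₂ κ₄) {g : ℝ × ℝ → ℝ} (hg2 : MemLp g 2)
    (hg4 : MemLp g 4) {X : Ω → ℝ} (hX : IsLevyIntegral P L g X) :
    IsFourthOrderIntegral P L g X := by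
  obtain ⟨φ, hφ, hφlim, hφA, hφX⟩ := hX
  obtain ⟨ψ, hψ, hψlim, h2, h4⟩ := exists_simpleFunc_tendsto hg2 hg4
  have hconv : ∀ A, MeasurableSet A → ∃ Z : Ω → ℝ, MemLp Z 4 P ∧
      Tendsto (fun n => eLpNorm (fun ω => simpleLevyIntegral L (ψ n) A ω - Z ω) 4 P) atTop
        (𝓝 0) ∧ TendstoInMeasure P (fun n => simpleLevyIntegral L (ψ n) A) atTop Z := by
    intro A hA
    obtain ⟨Z, hZ, ht⟩ := h.exists_tendsto_eLpNorm hg2 hg4 hψ h2 h4 hA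
    exact ⟨Z, hZ, ht, tendstoInMeasure_of_tendsto_eLpNorm (by norm_num)
      (fun n => (h.memLp_simpleLevyIntegral (hψ n) hA).1) hZ.1 ht⟩
  have hsub : ∀ A, MeasurableSet A → ∀ U V : Ω → ℝ,
      TendstoInMeasure P (fun n => simpleLevyIntegral L (φ n) A) atTop U →
      TendstoInMeasure P (fun n => simpleLevyIntegral L (ψ n) A) atTop V →
      TendstoInMeasure P (fun n => simpleLevyIntegral L (φ n - ψ n) A) atTop
        (fun ω => U ω - V ω) := fun A hA U V hU hV =>
    (hU.sub hV).congr_left fun n => (h.simpleLevyIntegral_sub (hφ n) (hψ n) hA).symm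
  obtain ⟨Z, hZ4, hZt, hZm⟩ := hconv Set.univ .univ
  -- The sequences `φ` and `ψ` have the same limit almost everywhere, and the integrals of `φ n - ψ
  -- n` converge in probability over every Borel set; the gliding hump makes their limit vanish.
  have hz := h.ae_eq_zero_of_tendstoInMeasure (φ := fun n => φ n - ψ n) (fun n => ?_) ?_ ?_
    (hsub Set.univ .univ X Z hφX hZm)
  · have hXZ : X =ᵐ[P] Z := by
      filter_upwards [hz] with ω hω
      exact sub_eq_zero.1 hω
    refine ⟨hg2, hg4, (memLp_congr_ae hXZ).2 hZ4, ψ, hψ, h2, h4, hZt.congr fun n => ?_⟩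
    refine eLpNorm_congr_ae ?_
    filter_upwards [hXZ] with ω hω
    rw [hω]
  · rw [SimpleFunc.coe_sub]
    exact ((hφ n).union (hψ n)).subset (Function.support_sub _ _)
  · filter_upwards [hφlim, hψlim] with z h1 h2
    simpa using h1.sub h2
  · intro A hA
    obtain ⟨U, hU⟩ := hφA A hA
    obtain ⟨V, -, -, hV⟩ := hconv A hA
    exact ⟨_, hsub A hA U V hU hV⟩

end IsFourthOrderRandomMeasure

end

/-! ### Polarization and mixed fourth moments. -/

section Polarization

variable {α : Type*} [MeasurableSpace α] {μ : Measure α}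

lemma MeasureTheory.MemLp.integrable_mul_mul_mul {X₁ X₂ X₃ X₄ : α → ℝ} (h₁ : MemLp X₁ 4 μ)
    (h₂ : MemLp X₂ 4 μ) (h₃ : MemLp X₃ 4 μ) (h₄ : MemLp X₄ 4 μ) :
    Integrable (fun a => X₁ a * X₂ a * X₃ a * X₄ a) μ := by
  refine ((((h₁.integrable_pow_four.add h₂.integrable_pow_four).add
    h₃.integrable_pow_four).add h₄.integrable_pow_four)).mono'
    (((h₁.1.mul h₂.1).mul h₃.1).mul h₄.1) (ae_of_all _ fun a => ?_)
  simp only [Pi.add_apply]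
  rw [Real.norm_eq_abs, abs_le]
  constructor <;>
  nlinarith [sq_nonneg (X₁ a * X₂ a + X₃ a * X₄ a), sq_nonneg (X₁ a * X₂ a - X₃ a * X₄ a),
    sq_nonneg (X₁ a ^ 2 - X₂ a ^ 2), sq_nonneg (X₃ a ^ 2 - X₄ a ^ 2), sq_nonneg (X₁ a ^ 2),
    sq_nonneg (X₂ a ^ 2), sq_nonneg (X₃ a ^ 2), sq_nonneg (X₄ a ^ 2)]

/-- Polarization of the quartic form `X ↦ ∫ X⁴`. -/
lemma integral_mul_mul_mul_eq_polarization {X₁ X₂ X₃ X₄ : α → ℝ} (h₁ : MemLp X₁ 4 μ)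
    (h₂ : MemLp X₂ 4 μ) (h₃ : MemLp X₃ 4 μ) (h₄ : MemLp X₄ 4 μ) {q : ℝ → ℝ → ℝ → ℝ}
    (hq : ∀ e₁ e₂ e₃, q e₁ e₂ e₃ = ∫ a, (e₁ • X₁ + e₂ • X₂ + e₃ • X₃ + X₄) a ^ 4 ∂μ) :
    192 * ∫ a, X₁ a * X₂ a * X₃ a * X₄ a ∂μ
      = q 1 1 1 - q 1 1 (-1) - q 1 (-1) 1 - q (-1) 1 1 + q 1 (-1) (-1) + q (-1) 1 (-1)
        + q (-1) (-1) 1 - q (-1) (-1) (-1) := by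
  have hi : ∀ e₁ e₂ e₃ : ℝ,
      Integrable (fun a => (e₁ • X₁ + e₂ • X₂ + e₃ • X₃ + X₄) a ^ 4) μ := fun e₁ e₂ e₃ =>
    ((((h₁.const_smul e₁).add (h₂.const_smul e₂)).add (h₃.const_smul e₃)).add
      h₄).integrable_pow_four
  simp only [hq]
  rw [← integral_const_mul]
  have sb : ∀ {u v : α → ℝ}, Integrable u μ → Integrable v μ →
      Integrable (fun a => u a - v a) μ := fun hu hv => hu.sub hv
  have i1 := sb (hi 1 1 1) (hi 1 1 (-1))
  have i2 := sb i1 (hi 1 (-1) 1)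
  have i3 := sb i2 (hi (-1) 1 1)
  have i4 := i3.fun_add (hi 1 (-1) (-1))
  have i5 := i4.fun_add (hi (-1) 1 (-1))
  have i6 := i5.fun_add (hi (-1) (-1) 1)
  rw [← integral_sub (hi _ _ _) (hi _ _ _), ← integral_sub i1 (hi _ _ _),
    ← integral_sub i2 (hi _ _ _), ← integral_add i3 (hi _ _ _), ← integral_add i4 (hi _ _ _),
    ← integral_add i5 (hi _ _ _), ← integral_sub i6 (hi _ _ _)]
  -- The signed sum keeps only monomials odd in each of `X₁, X₂, X₃`; in degree four that is
  -- `X₁X₂X₃X₄` alone, with coefficient `4!` in each of the `8` terms, and `8 · 24 = 192`.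
  refine integral_congr_ae (ae_of_all _ fun a => ?_)
  simp only [Pi.add_apply, Pi.smul_apply, smul_eq_mul]
  ring

lemma integral_sq_add {X Y : α → ℝ} (hX : MemLp X 2 μ) (hY : MemLp Y 2 μ) :
    ∫ a, (X + Y) a ^ 2 ∂μ
      = ∫ a, X a ^ 2 ∂μ + 2 * ∫ a, X a * Y a ∂μ + ∫ a, Y a ^ 2 ∂μ := by
  have hXY : Integrable (fun a => 2 * (X a * Y a)) μ := (hX.integrable_mul hY).const_mul 2
  rw [← integral_const_mul, ← integral_add hX.integrable_sq hXY,
    ← integral_add (hX.integrable_sq.fun_add hXY) hY.integrable_sq]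
  refine integral_congr_ae (ae_of_all _ fun a => ?_)
  simp only [Pi.add_apply]
  ring

lemma integral_add_mul {X Y Z : α → ℝ} (hX : MemLp X 2 μ) (hY : MemLp Y 2 μ) (hZ : MemLp Z 2 μ) :
    ∫ a, (X + Y) a * Z a ∂μ = ∫ a, X a * Z a ∂μ + ∫ a, Y a * Z a ∂μ := by
  have h1 : Integrable (fun a => X a * Z a) μ := hX.integrable_mul hZ
  have h2 : Integrable (fun a => Y a * Z a) μ := hY.integrable_mul hZ
  rw [← integral_add h1 h2]
  refine integral_congr_ae (ae_of_all _ fun a => ?_)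
  simp only [Pi.add_apply]
  ring

lemma integral_smul_mul (c : ℝ) (X Z : α → ℝ) :
    ∫ a, (c • X) a * Z a ∂μ = c * ∫ a, X a * Z a ∂μ := by
  rw [← integral_const_mul]
  refine integral_congr_ae (ae_of_all _ fun a => ?_)
  simp only [Pi.smul_apply, smul_eq_mul]
  ring

lemma integral_mul_smul (c : ℝ) (X Z : α → ℝ) :
    ∫ a, X a * (c • Z) a ∂μ = c * ∫ a, X a * Z a ∂μ := by
  rw [← integral_const_mul]
  refine integral_congr_ae (ae_of_all _ fun a => ?_)
  simp only [Pi.smul_apply, smul_eq_mul]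
  ring

lemma integral_smul_sq (c : ℝ) (X : α → ℝ) :
    ∫ a, (c • X) a ^ 2 ∂μ = c ^ 2 * ∫ a, X a ^ 2 ∂μ := by
  rw [← integral_const_mul]
  refine integral_congr_ae (ae_of_all _ fun a => ?_)
  simp only [Pi.smul_apply, smul_eq_mul]
  ring

lemma integral_sq_linearCombination {X₁ X₂ X₃ X₄ : α → ℝ} (h₁ : MemLp X₁ 2 μ)
    (h₂ : MemLp X₂ 2 μ) (h₃ : MemLp X₃ 2 μ) (h₄ : MemLp X₄ 2 μ) (e₁ e₂ e₃ : ℝ) :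
    ∫ a, (e₁ • X₁ + e₂ • X₂ + e₃ • X₃ + X₄) a ^ 2 ∂μ
      = e₁ ^ 2 * ∫ a, X₁ a ^ 2 ∂μ + e₂ ^ 2 * ∫ a, X₂ a ^ 2 ∂μ + e₃ ^ 2 * ∫ a, X₃ a ^ 2 ∂μ
        + ∫ a, X₄ a ^ 2 ∂μ + 2 * (e₁ * e₂ * ∫ a, X₁ a * X₂ a ∂μ + e₁ * e₃ * ∫ a, X₁ a * X₃ a ∂μ
        + e₂ * e₃ * ∫ a, X₂ a * X₃ a ∂μ + e₁ * ∫ a, X₁ a * X₄ a ∂μ + e₂ * ∫ a, X₂ a * X₄ a ∂μ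
        + e₃ * ∫ a, X₃ a * X₄ a ∂μ) := by
  have k₁ := h₁.const_smul e₁
  have k₂ := h₂.const_smul e₂
  have k₃ := h₃.const_smul e₃
  rw [integral_sq_add ((k₁.add k₂).add k₃) h₄, integral_sq_add (k₁.add k₂) k₃,
    integral_sq_add k₁ k₂, integral_add_mul (k₁.add k₂) k₃ h₄, integral_add_mul k₁ k₂ h₄,
    integral_add_mul k₁ k₂ k₃]
  simp only [integral_smul_mul, integral_mul_smul, integral_smul_sq]
  ring

end Polarization

section

variable {Ω : Type*} [MeasurableSpace Ω] {P : Measure Ω} {L : Set (ℝ × ℝ) → Ω → ℝ} {κ₂ κ₄ : ℝ}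

namespace IsFourthOrderRandomMeasure

theorem integral_mul_of_isFourthOrderIntegral [IsProbabilityMeasure P]
    (h : IsFourthOrderRandomMeasure P L κ₂ κ₄) {g₁ g₂ : ℝ × ℝ → ℝ} {X₁ X₂ : Ω → ℝ}
    (h₁ : IsFourthOrderIntegral P L g₁ X₁) (h₂ : IsFourthOrderIntegral P L g₂ X₂) :
    ∫ ω, X₁ ω * X₂ ω ∂P = κ₂ * ∫ z, g₁ z * g₂ z := by
  have e := (h.moments_of_isFourthOrderIntegral (h₁.add h h₂)).2.1
  rw [integral_sq_add (h₁.2.2.1.mono_exponent (by norm_num))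
    (h₂.2.2.1.mono_exponent (by norm_num)), integral_sq_add h₁.1 h₂.1,
    (h.moments_of_isFourthOrderIntegral h₁).2.1, (h.moments_of_isFourthOrderIntegral h₂).2.1] at e
  linarith

/-- Both sides of the fourth-moment formula are polarized: `∫ g⁴` becomes `∫ g₁g₂g₃g₄`, and the
square of the quadratic form `∫ g²` becomes the three pairings. -/
theorem integral_mul_mul_mul_of_isFourthOrderIntegral [IsProbabilityMeasure P]
    (h : IsFourthOrderRandomMeasure P L κ₂ κ₄) {g₁ g₂ g₃ g₄ : ℝ × ℝ → ℝ} {X₁ X₂ X₃ X₄ : Ω → ℝ}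
    (h₁ : IsFourthOrderIntegral P L g₁ X₁) (h₂ : IsFourthOrderIntegral P L g₂ X₂)
    (h₃ : IsFourthOrderIntegral P L g₃ X₃) (h₄ : IsFourthOrderIntegral P L g₄ X₄) :
    ∫ ω, X₁ ω * X₂ ω * X₃ ω * X₄ ω ∂P
      = κ₄ * (∫ z, g₁ z * g₂ z * g₃ z * g₄ z)
        + κ₂ ^ 2 * ((∫ z, g₁ z * g₂ z) * (∫ z, g₃ z * g₄ z)
          + (∫ z, g₁ z * g₃ z) * (∫ z, g₂ z * g₄ z)
          + (∫ z, g₁ z * g₄ z) * (∫ z, g₂ z * g₃ z)) := by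
  have hc := fun e₁ e₂ e₃ : ℝ => (h.moments_of_isFourthOrderIntegral
    ((((h₁.smul h e₁).add h (h₂.smul h e₂)).add h (h₃.smul h e₃)).add h h₄)).2.2
  have hP := integral_mul_mul_mul_eq_polarization h₁.2.2.1 h₂.2.2.1 h₃.2.2.1 h₄.2.2.1
    (fun _ _ _ => rfl)
  have hV := integral_mul_mul_mul_eq_polarization h₁.2.1 h₂.2.1 h₃.2.1 h₄.2.1
    (fun _ _ _ => rfl)
  simp only [hc, integral_sq_linearCombination h₁.1 h₂.1 h₃.1 h₄.1] at hP
  linear_combination (1 / 192) * hP - (κ₄ / 192) * hV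

end IsFourthOrderRandomMeasure

/-! ### Autocovariances and fourth-order covariances of the moving average. -/

/-- Translation of the second coordinate. -/
def shiftSnd (t : ℝ) (z : ℝ × ℝ) : ℝ × ℝ := (z.1, z.2 + t)

lemma measurePreserving_reflectSnd (t : ℝ) :
    MeasurePreserving (fun z : ℝ × ℝ => (z.1, t - z.2)) volume volume :=
  (MeasurePreserving.id volume).prod (Measure.measurePreserving_sub_left volume t)

/-- The substitution `u = t - s` turns integrals of the kernels `f(x, t - s)` into integrals of
translates of `f`, so that only time differences remain. -/
lemma integral_reflectSnd (t : ℝ) (F : ℝ × ℝ → ℝ) :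
    ∫ z : ℝ × ℝ, F (z.1, t - z.2) = ∫ z, F z :=
  (measurePreserving_reflectSnd t).integral_comp
    ((MeasurableEquiv.refl ℝ).prodCongr (MeasurableEquiv.subLeft t)).measurableEmbedding F

namespace IsFourthOrderRandomMeasure

variable {f : ℝ × ℝ → ℝ} {Y : ℝ → Ω → ℝ}

lemma isFourthOrderIntegral_of_isMMAP [IsProbabilityMeasure P]
    (h : IsFourthOrderRandomMeasure P L κ₂ κ₄) (hf2 : MemLp f 2) (hf4 : MemLp f 4)
    (hY : IsMMAP P L f Y) (t : ℝ) :
    IsFourthOrderIntegral P L (fun z => f (z.1, t - z.2)) (Y t) :=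
  h.isFourthOrderIntegral_of_isLevyIntegral
    (hf2.comp_measurePreserving (measurePreserving_reflectSnd t))
    (hf4.comp_measurePreserving (measurePreserving_reflectSnd t)) (hY t)

lemma memLp_of_isMMAP [IsProbabilityMeasure P]
    (h : IsFourthOrderRandomMeasure P L κ₂ κ₄) (hf2 : MemLp f 2) (hf4 : MemLp f 4)
    (hY : IsMMAP P L f Y) (t : ℝ) : MemLp (Y t) 4 P :=
  (h.isFourthOrderIntegral_of_isMMAP hf2 hf4 hY t).2.2.1

lemma integral_mul_of_isMMAP [IsProbabilityMeasure P]
    (h : IsFourthOrderRandomMeasure P L κ₂ κ₄) (hf2 : MemLp f 2) (hf4 : MemLp f 4)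
    (hY : IsMMAP P L f Y) (s t : ℝ) :
    ∫ ω, Y s ω * Y t ω ∂P = κ₂ * ∫ z, f z * f (shiftSnd (t - s) z) := by
  rw [h.integral_mul_of_isFourthOrderIntegral (h.isFourthOrderIntegral_of_isMMAP hf2 hf4 hY s)
    (h.isFourthOrderIntegral_of_isMMAP hf2 hf4 hY t),
    ← integral_reflectSnd s fun z => f z * f (shiftSnd (t - s) z)]
  simp [shiftSnd]

lemma autocov_eq [IsProbabilityMeasure P]
    (h : IsFourthOrderRandomMeasure P L κ₂ κ₄) (hf2 : MemLp f 2) (hf4 : MemLp f 4)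
    (hY : IsMMAP P L f Y) (t : ℝ) :
    autocov P Y t = κ₂ * ∫ z, f z * f (shiftSnd t z) := by
  rw [autocov, covariance_eq_sub ((h.memLp_of_isMMAP hf2 hf4 hY 0).mono_exponent (by norm_num))
    ((h.memLp_of_isMMAP hf2 hf4 hY t).mono_exponent (by norm_num)),
    (h.moments_of_isFourthOrderIntegral (h.isFourthOrderIntegral_of_isMMAP hf2 hf4 hY 0)).1]
  simpa using h.integral_mul_of_isMMAP hf2 hf4 hY 0 t

lemma integral_mul_eq_autocov [IsProbabilityMeasure P]
    (h : IsFourthOrderRandomMeasure P L κ₂ κ₄) (hf2 : MemLp f 2) (hf4 : MemLp f 4)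
    (hY : IsMMAP P L f Y) (s t : ℝ) : ∫ ω, Y s ω * Y t ω ∂P = autocov P Y (t - s) := by
  rw [h.autocov_eq hf2 hf4 hY, h.integral_mul_of_isMMAP hf2 hf4 hY]

lemma autocov_neg [IsProbabilityMeasure P]
    (h : IsFourthOrderRandomMeasure P L κ₂ κ₄) (hf2 : MemLp f 2) (hf4 : MemLp f 4)
    (hY : IsMMAP P L f Y) (t : ℝ) : autocov P Y (-t) = autocov P Y t := by
  have h1 := h.integral_mul_eq_autocov hf2 hf4 hY t 0
  have h2 := h.integral_mul_eq_autocov hf2 hf4 hY 0 t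
  rw [zero_sub] at h1
  rw [sub_zero] at h2
  rw [← h1, ← h2]
  simp_rw [mul_comm]

lemma memLp_mul_of_isMMAP [IsProbabilityMeasure P]
    (h : IsFourthOrderRandomMeasure P L κ₂ κ₄) (hf2 : MemLp f 2) (hf4 : MemLp f 4)
    (hY : IsMMAP P L f Y) (s t : ℝ) : MemLp (fun ω => Y s ω * Y t ω) 2 P :=
  (h.memLp_of_isMMAP hf2 hf4 hY t).mul (h.memLp_of_isMMAP hf2 hf4 hY s)
    (hpqr := ⟨by
      rw [show (4 : ENNReal) = 2 * 2 by norm_num, ENNReal.mul_inv (by simp) (by simp), ← two_mul,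
        ← mul_assoc, ENNReal.mul_inv_cancel (by simp) (by simp), one_mul]⟩)

/-- Covariance of products of two values of a mixed moving average process. -/
lemma covariance_mul_mul_of_isMMAP [IsProbabilityMeasure P]
    (h : IsFourthOrderRandomMeasure P L κ₂ κ₄) (hf2 : MemLp f 2) (hf4 : MemLp f 4)
    (hY : IsMMAP P L f Y) (t₁ t₂ t₃ t₄ : ℝ) :
    cov[fun ω => Y t₁ ω * Y t₂ ω, fun ω => Y t₃ ω * Y t₄ ω; P]
      = κ₄ * (∫ z, f z * f (shiftSnd (t₂ - t₁) z) * f (shiftSnd (t₃ - t₁) z)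
          * f (shiftSnd (t₄ - t₁) z))
        + (autocov P Y (t₃ - t₁) * autocov P Y (t₄ - t₂)
          + autocov P Y (t₄ - t₁) * autocov P Y (t₃ - t₂)) := by
  have hp := h.memLp_mul_of_isMMAP hf2 hf4 hY
  have hX := h.isFourthOrderIntegral_of_isMMAP hf2 hf4 hY
  rw [covariance_eq_sub (hp _ _) (hp _ _)]
  simp only [Pi.mul_apply]
  have e := h.integral_mul_mul_mul_of_isFourthOrderIntegral (hX t₁) (hX t₂) (hX t₃) (hX t₄)
  have e2 : ∀ s t, autocov P Y (t - s) = κ₂ * ∫ z : ℝ × ℝ, f (z.1, s - z.2) * f (z.1, t - z.2) :=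
    fun s t => by
      rw [← h.integral_mul_eq_autocov hf2 hf4 hY,
        h.integral_mul_of_isFourthOrderIntegral (hX s) (hX t)]
  have e3 : ∫ z, f z * f (shiftSnd (t₂ - t₁) z) * f (shiftSnd (t₃ - t₁) z)
      * f (shiftSnd (t₄ - t₁) z)
      = ∫ z : ℝ × ℝ, f (z.1, t₁ - z.2) * f (z.1, t₂ - z.2) * f (z.1, t₃ - z.2)
        * f (z.1, t₄ - z.2) := by
    rw [← integral_reflectSnd t₁ fun z => f z * f (shiftSnd (t₂ - t₁) z) *
      f (shiftSnd (t₃ - t₁) z) * f (shiftSnd (t₄ - t₁) z)]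
    simp [shiftSnd]
  rw [e3, h.integral_mul_eq_autocov hf2 hf4 hY, h.integral_mul_eq_autocov hf2 hf4 hY,
    e2 t₁ t₂, e2 t₃ t₄, e2 t₁ t₃, e2 t₂ t₄, e2 t₁ t₄, e2 t₂ t₃]
  simp only [← mul_assoc] at e ⊢
  rw [e]
  ring

end IsFourthOrderRandomMeasure

end

/-! ### Cesàro means of a function of the difference. -/

/-- The mean over `n²` pairs of a summable function of the difference, multiplied by `n`, converges
to the sum of the function. -/
lemma tendsto_cesaro_sum_sub {c : ℤ → ℝ} (hc : Summable c) :
    Tendsto (fun n : ℕ => (n : ℝ)⁻¹ * ∑ j ∈ Finset.Icc 1 n, ∑ k ∈ Finset.Icc 1 n,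
      c ((k : ℤ) - (j : ℤ))) atTop (𝓝 (∑' l, c l)) := by
  set u : ℕ → ℝ := fun n =>
    (∑ i ∈ Finset.range n, c ((i : ℤ) + 1)) + c 0 + ∑ i ∈ Finset.range n, c (-((i : ℤ) + 1)) with hu
  have h1 : Summable (fun n : ℕ => c ((n : ℤ) + 1)) :=
    hc.comp_injective (i := fun n : ℕ => (n : ℤ) + 1) fun a b hab => by simpa using hab
  have h2 : Summable (fun n : ℕ => c (-((n : ℤ) + 1))) :=
    hc.comp_injective (i := fun n : ℕ => -((n : ℤ) + 1)) fun a b hab => by simpa using hab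
  have hlim : Tendsto u atTop (𝓝 (∑' l, c l)) := by
    rw [(HasSum.of_add_one_of_neg_add_one h1.hasSum h2.hasSum).tsum_eq]
    exact (h1.hasSum.tendsto_sum_nat.add_const _).add h2.hasSum.tendsto_sum_nat
  -- Enlarging the square from `n` to `n + 1` adds a row, a column and a corner, whose differences
  -- run once through `-n, …, n`; these terms sum to `u n`.
  have hD : ∀ n : ℕ, ∑ j ∈ Finset.Icc 1 n, ∑ k ∈ Finset.Icc 1 n, c ((k : ℤ) - (j : ℤ))
      = ∑ m ∈ Finset.range n, u m := by
    intro n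
    induction n with
    | zero => simp
    | succ n ih =>
      have hr : ∀ g : ℕ → ℝ, ∑ j ∈ Finset.Icc 1 n, g (n + 1 - j)
          = ∑ i ∈ Finset.range n, g (i + 1) := by
        intro g
        rw [Finset.range_eq_Ico, Finset.sum_Ico_add' g 0 n 1]
        refine Finset.sum_nbij' (fun j => n + 1 - j) (fun j => n + 1 - j) ?_ ?_ ?_ ?_ ?_ <;>
          intro j hj <;> simp at hj ⊢ <;> omega
      rw [Finset.sum_range_succ, ← ih, Finset.sum_Icc_succ_top (by omega)]
      simp_rw [Finset.sum_Icc_succ_top (show 1 ≤ n + 1 by omega)]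
      rw [Finset.sum_add_distrib, hu]
      have e1 : ∑ j ∈ Finset.Icc 1 n, c (((n + 1 : ℕ) : ℤ) - (j : ℤ))
          = ∑ i ∈ Finset.range n, c ((i : ℤ) + 1) := by
        have := hr (fun i => c (i : ℤ))
        push_cast at this
        rw [← this]
        refine Finset.sum_congr rfl fun j hj => ?_
        rw [Nat.cast_sub (by simp at hj; omega)]
      have e2 : ∑ k ∈ Finset.Icc 1 n, c ((k : ℤ) - ((n + 1 : ℕ) : ℤ))
          = ∑ i ∈ Finset.range n, c (-((i : ℤ) + 1)) := by
        have := hr (fun i => c (-(i : ℤ)))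
        push_cast at this
        rw [← this]
        refine Finset.sum_congr rfl fun j hj => ?_
        rw [Nat.cast_sub (by simp at hj; omega)]
        congr 1
        ring
      rw [e1, e2, sub_self]
      ring
  simp_rw [hD]
  exact hlim.cesaro

/-! ### Unfolding over strips and periodized products. -/

lemma shiftSnd_shiftSnd (s t : ℝ) (z : ℝ × ℝ) : shiftSnd s (shiftSnd t z) = shiftSnd (t + s) z := by
  simp [shiftSnd, add_assoc]

lemma measurePreserving_shiftSnd (t : ℝ) : MeasurePreserving (shiftSnd t) volume volume :=
  (MeasurePreserving.id volume).prod (measurePreserving_add_right volume t)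

lemma measurableEmbedding_shiftSnd (t : ℝ) : MeasurableEmbedding (shiftSnd t) :=
  ((MeasurableEquiv.refl ℝ).prodCongr (MeasurableEquiv.addRight t)).measurableEmbedding

/-- The closed strip differs by a null line from the half-open one, whose translates by multiples of
`Δ > 0` tile the plane. -/
lemma stripVolume_eq_restrict_Ioc (Δ : ℝ) :
    stripVolume Δ = volume.restrict (Set.univ ×ˢ Set.Ioc 0 Δ) := by
  rw [stripVolume]
  refine Measure.restrict_congr_set ?_
  rw [Measure.volume_eq_prod]
  exact Measure.set_prod_ae_eq (ae_eq_refl _) Ioc_ae_eq_Icc.symm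

/-- Unfolding an integral over the plane into the strips `ℝ × (jΔ, (j+1)Δ]`. -/
lemma hasSum_integral_stripVolume {Δ : ℝ} (hΔ : 0 < Δ) {F : ℝ × ℝ → ℝ} (hF : Integrable F) :
    HasSum (fun j : ℤ => ∫ z, F (shiftSnd (j * Δ) z) ∂(stripVolume Δ)) (∫ z, F z) := by
  set s : ℤ → Set (ℝ × ℝ) := fun j => Set.univ ×ˢ Set.Ioc (j • Δ) ((j + 1) • Δ) with hs
  have hunion : ⋃ j, s j = Set.univ := by
    rw [hs, ← Set.prod_iUnion, iUnion_Ioc_zsmul hΔ, Set.univ_prod_univ]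
  have hd : Pairwise (Function.onFun Disjoint s) := fun i j hij =>
    Set.Disjoint.set_prod_right (Set.pairwise_disjoint_Ioc_zsmul Δ hij) _ _
  have h := hasSum_integral_iUnion (μ := volume) (f := F)
    (fun j => MeasurableSet.univ.prod measurableSet_Ioc) hd (hF.integrableOn)
  rw [hunion, setIntegral_univ] at h
  have e : (fun j : ℤ => ∫ z, F (shiftSnd (j * Δ) z) ∂(stripVolume Δ)) = fun j => ∫ z in s j, F z :=
    funext fun j => ?_
  · rw [e]; exact h
  rw [stripVolume_eq_restrict_Ioc,
    ← (measurePreserving_shiftSnd (j * Δ)).setIntegral_preimage_emb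
      (measurableEmbedding_shiftSnd _) F (s j)]
  congr 2
  ext z
  simp only [shiftSnd, hs, Set.mem_prod, Set.mem_univ, true_and, Set.mem_preimage, Set.mem_Ioc,
    zsmul_eq_mul]
  push_cast
  constructor <;> rintro ⟨h1, h2⟩ <;> constructor <;> linarith

/-- A sequence of nonnegative functions with summable integrals is summable almost everywhere. -/
lemma ae_summable_of_summable_integral {α ι : Type*} [MeasurableSpace α] [Countable ι]
    {μ : Measure α} {u : ι → α → ℝ} (hu : ∀ i, Integrable (u i) μ) (h0 : ∀ i a, 0 ≤ u i a)
    (hs : Summable fun i => ∫ a, u i a ∂μ) : ∀ᵐ a ∂μ, Summable fun i => u i a := by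
  have h1 : ∫⁻ a, ∑' i, ENNReal.ofReal (u i a) ∂μ ≠ ⊤ := by
    rw [lintegral_tsum fun i => (hu i).1.aemeasurable.ennreal_ofReal]
    simp_rw [← fun i => ofReal_integral_eq_lintegral_ofReal (hu i) (ae_of_all _ (h0 i))]
    exact hs.tsum_ofReal_ne_top
  filter_upwards [ae_lt_top' (AEMeasurable.tsum
    fun i => (hu i).1.aemeasurable.ennreal_ofReal) h1] with a ha
  have := ENNReal.summable_toReal ha.ne
  simpa [ENNReal.toReal_ofReal (h0 _ a)] using this

lemma abs_mul_le_half_sq_add_sq (x y : ℝ) : |x * y| ≤ (x ^ 2 + y ^ 2) / 2 := by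
  rw [abs_le]
  constructor <;> nlinarith [sq_nonneg (x + y), sq_nonneg (x - y)]

/-- The lagged products of a square-summable sequence are summable with sum at most the sum of
squares. -/
lemma Summable.abs_mul_lag {a : ℤ → ℝ} (ha : Summable fun j => a j ^ 2) (q : ℤ) :
    Summable (fun j => |a j * a (j + q)|) ∧ ∑' j, |a j * a (j + q)| ≤ ∑' j, a j ^ 2 := by
  have hq : Summable fun j => a (j + q) ^ 2 :=
    (Equiv.addRight q).summable_iff (f := fun j => a j ^ 2) |>.2 ha
  have hqe : ∑' j, a (j + q) ^ 2 = ∑' j, a j ^ 2 :=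
    (Equiv.addRight q).tsum_eq fun j => a j ^ 2
  have hh : Summable fun j => (a j ^ 2 + a (j + q) ^ 2) / 2 := (ha.add hq).div_const 2
  have hs : Summable (fun j => |a j * a (j + q)|) :=
    hh.of_nonneg_of_le (fun _ => abs_nonneg _) fun j => abs_mul_le_half_sq_add_sq _ _
  refine ⟨hs, (hs.tsum_le_tsum (fun j => abs_mul_le_half_sq_add_sq _ _) hh).trans_eq ?_⟩
  rw [tsum_div_const, ha.tsum_add hq, hqe]
  ring

section Periodization

variable {f : ℝ × ℝ → ℝ} {Δ : ℝ}

lemma periodizedProduct_eq (q : ℤ) (z : ℝ × ℝ) :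
    periodizedProduct f Δ q z
      = ∑' j : ℤ, f (shiftSnd (j * Δ) z) * f (shiftSnd (((j + q : ℤ) : ℝ) * Δ) z) := by
  simp [periodizedProduct, shiftSnd]

lemma ae_summable_sq_shiftSnd (hΔ : 0 < Δ) (hf2 : MemLp f 2) :
    ∀ᵐ z ∂(stripVolume Δ), Summable fun j : ℤ => f (shiftSnd (j * Δ) z) ^ 2 := by
  refine ae_summable_of_summable_integral (fun j => ?_) (fun j z => sq_nonneg _)
    (hasSum_integral_stripVolume hΔ hf2.integrable_sq).summable
  exact ((hf2.comp_measurePreserving (measurePreserving_shiftSnd (j * Δ))).integrable_sq).restrict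

lemma aestronglyMeasurable_shiftSnd (hf2 : MemLp f 2) (t : ℝ) :
    AEStronglyMeasurable (fun z => f (shiftSnd t z)) (stripVolume Δ) :=
  (hf2.comp_measurePreserving (measurePreserving_shiftSnd t)).1.restrict

/-- The periodized products are square-integrable over the strip. -/
theorem memLp_periodizedProduct (hΔ : 0 < Δ) (hf2 : MemLp f 2)
    (hper : MemLp (fun z : ℝ × ℝ => ∑' j : ℤ, f (z.1, z.2 + (j : ℝ) * Δ) ^ 2) 2 (stripVolume Δ))
    (q : ℤ) : MemLp (periodizedProduct f Δ q) 2 (stripVolume Δ) := by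
  change MemLp (fun z : ℝ × ℝ => ∑' j : ℤ, f (shiftSnd (j * Δ) z) ^ 2) 2 (stripVolume Δ) at hper
  have hae := ae_summable_sq_shiftSnd hΔ hf2
  refine hper.of_le ?_ ?_
  · refine aestronglyMeasurable_of_tendsto_ae (u := (atTop : Filter (Finset ℤ)))
      (f := fun s z => ∑ j ∈ s, f (shiftSnd (j * Δ) z) * f (shiftSnd (((j + q : ℤ) : ℝ) * Δ) z))
      (fun s => Finset.aestronglyMeasurable_fun_sum s fun j _ =>
        (aestronglyMeasurable_shiftSnd hf2 _).mul (aestronglyMeasurable_shiftSnd hf2 _)) ?_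
    filter_upwards [hae] with z hz
    rw [periodizedProduct_eq]
    exact (hz.abs_mul_lag (a := fun j : ℤ => f (shiftSnd (j * Δ) z)) q).1.of_abs.hasSum
  · filter_upwards [hae] with z hz
    have h := hz.abs_mul_lag (a := fun j : ℤ => f (shiftSnd (j * Δ) z)) q
    rw [periodizedProduct_eq]
    have h1 := norm_tsum_le_tsum_norm (f := fun j : ℤ => f (shiftSnd (j * Δ) z) *
      f (shiftSnd (((j + q : ℤ) : ℝ) * Δ) z)) h.1
    exact h1.trans (h.2.trans (le_abs_self _))

/-- Unfolding of `∑ₗ ∫ f(z) f(z + pΔ) f(z + lΔ) f(z + (l+q)Δ) dz` over the strip. -/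
theorem hasSum_integral_mul_mul_mul (hΔ : 0 < Δ) (hf2 : MemLp f 2) (hf4 : MemLp f 4)
    (hper : MemLp (fun z : ℝ × ℝ => ∑' j : ℤ, f (z.1, z.2 + (j : ℝ) * Δ) ^ 2) 2 (stripVolume Δ))
    (p q : ℤ) :
    HasSum (fun l : ℤ => ∫ z, f z * f (shiftSnd (p * Δ) z) * f (shiftSnd (l * Δ) z)
        * f (shiftSnd (((l + q : ℤ) : ℝ) * Δ) z))
      (∫ z, periodizedProduct f Δ p z * periodizedProduct f Δ q z ∂(stripVolume Δ)) := by
  set a : ℤ → ℝ × ℝ → ℝ := fun j z => f (shiftSnd (j * Δ) z) with ha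
  change MemLp (fun z : ℝ × ℝ => ∑' j : ℤ, a j z ^ 2) 2 (stripVolume Δ) at hper
  have ha4 : ∀ j, MemLp (a j) 4 := fun j =>
    hf4.comp_measurePreserving (measurePreserving_shiftSnd _)
  have hae : ∀ᵐ z ∂(stripVolume Δ), Summable fun j : ℤ => a j z ^ 2 :=
    ae_summable_sq_shiftSnd hΔ hf2
  set T : ℤ × ℤ → ℝ × ℝ → ℝ := fun x z =>
    a x.1 z * a (x.1 + p) z * (a x.2 z * a (x.2 + q) z) with hT
  have hTi : ∀ x, Integrable (T x) (stripVolume Δ) := fun x => by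
    have := ((ha4 x.1).integrable_mul_mul_mul (ha4 (x.1 + p)) (ha4 x.2) (ha4 (x.2 + q)))
    refine (this.congr (ae_of_all _ fun z => ?_)).restrict
    simp only [hT]
    ring
  have hprod : ∀ᵐ z ∂(stripVolume Δ), Summable (fun x => ‖T x z‖) ∧
      (∑' x, ‖T x z‖ ≤ (∑' j : ℤ, a j z ^ 2) ^ 2) ∧
      ∑' x, T x z = periodizedProduct f Δ p z * periodizedProduct f Δ q z := by
    filter_upwards [hae] with z hz
    obtain ⟨sp, lp⟩ := hz.abs_mul_lag (a := fun j => a j z) p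
    obtain ⟨sq', lq⟩ := hz.abs_mul_lag (a := fun j => a j z) q
    have hn : ∀ x, ‖T x z‖ = |a x.1 z * a (x.1 + p) z| * |a x.2 z * a (x.2 + q) z| := fun x => by
      rw [Real.norm_eq_abs, ← abs_mul]
    have hsum := sp.mul_of_nonneg sq' (fun _ => abs_nonneg _) (fun _ => abs_nonneg _)
    simp_rw [hn]
    refine ⟨hsum, ?_, ?_⟩
    · rw [← sp.tsum_mul_tsum sq' hsum, sq]
      exact mul_le_mul lp lq (tsum_nonneg fun _ => abs_nonneg _) (tsum_nonneg fun _ => sq_nonneg _)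
    · rw [periodizedProduct_eq, periodizedProduct_eq]
      exact (tsum_mul_tsum_of_summable_norm (f := fun j => a j z * a (j + p) z)
        (g := fun j => a j z * a (j + q) z) sp sq').symm
  -- Every finite sum of the `‖T x‖` is bounded by `(∑ f²)²`, integrable by the assumption on the
  -- periodized square. This licenses summation under the integral in any order.
  have hsumm : Summable fun x => ∫ z, ‖T x z‖ ∂(stripVolume Δ) := by
    refine summable_of_sum_le (c := ∫ z, (∑' j : ℤ, a j z ^ 2) ^ 2 ∂(stripVolume Δ))
      (fun x => integral_nonneg fun z => norm_nonneg _) fun s => ?_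
    rw [← integral_finsetSum _ fun x _ => (hTi x).norm]
    refine integral_mono_ae (integrable_finsetSum _ fun x _ => (hTi x).norm) hper.integrable_sq ?_
    filter_upwards [hprod] with z hz
    exact (hz.1.sum_le_tsum s fun _ _ => norm_nonneg _).trans hz.2.1
  have hmain := hasSum_integral_of_summable_integral_norm hTi hsumm
  rw [integral_congr_ae (g := fun z => periodizedProduct f Δ p z * periodizedProduct f Δ q z)
    (hprod.mono fun z hz => hz.2.2)] at hmain
  -- Pairs of shifts `(i, i + l)` are grouped by their difference `l`; for fixed `l` the sum over
  -- `i` refolds the strips into an integral over the plane.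
  let e : ℤ × ℤ ≃ ℤ × ℤ :=
    { toFun := fun x => (x.2, x.2 + x.1)
      invFun := fun x => (x.2 - x.1, x.1)
      left_inv := fun x => by simp
      right_inv := fun x => by simp }
  have hmain' := (e.hasSum_iff).2 hmain
  refine hmain'.prod_fiberwise fun l => ?_
  have hF : Integrable (fun z => f z * f (shiftSnd (p * Δ) z) * f (shiftSnd (l * Δ) z)
        * f (shiftSnd (((l + q : ℤ) : ℝ) * Δ) z)) :=
    hf4.integrable_mul_mul_mul (ha4 p) (ha4 l) (ha4 (l + q))
  have hH := hasSum_integral_stripVolume hΔ hF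
  refine (congrArg (HasSum · _) (funext fun i =>
    integral_congr_ae (ae_of_all _ fun z => ?_))).mpr hH
  simp only [e, Equiv.coe_fn_mk, hT, ha, shiftSnd_shiftSnd, ← add_mul]
  push_cast
  simp only [add_assoc, mul_assoc]

end Periodization

/-! ### The Bartlett series and the limit of the covariances. -/

lemma summable_mul_shift {w : ℤ → ℝ} (hw : Summable fun j => |w j| ^ 2) (r s : ℤ) :
    Summable fun l => w (l + r) * w (l + s) := by
  have h : ∀ t : ℤ, Summable fun l => w (l + t) ^ 2 := fun t => by
    simp only [sq_abs] at hw
    exact (Equiv.addRight t).summable_iff (f := fun j => w j ^ 2) |>.2 hw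
  exact (((h r).add (h s)).div_const 2).of_norm_bounded fun l => abs_mul_le_half_sq_add_sq _ _

lemma summable_bartlettTerm {γ : ℝ → ℝ} {Δ : ℝ}
    (hγ : Summable fun j : ℤ => |γ (Δ * (j : ℝ))| ^ 2) (p q : ℕ) :
    Summable fun l : ℤ => bartlettTerm γ Δ p q l := by
  have h1 := summable_mul_shift (w := fun j : ℤ => γ (Δ * (j : ℝ))) hγ 0 ((p : ℤ) - q)
  have h2 := summable_mul_shift (w := fun j : ℤ => γ (Δ * (j : ℝ))) hγ (-(q : ℤ)) p
  refine (h1.add h2).congr fun l => ?_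
  rw [bartlettTerm]
  push_cast
  congr 3 <;> ring_nf

theorem mainTheorem4
    {Ω Ω' : Type*} [MeasurableSpace Ω] [MeasurableSpace Ω']
    (P : Measure Ω) [IsProbabilityMeasure P] (P' : Measure Ω') [IsProbabilityMeasure P']
    (ζ a : ℝ) (ν : Measure ℝ)
    (L : Set (ℝ × ℝ) → Ω → ℝ) (hL : IsHomogeneousLevyBasis P L ζ a ν)
    (L' : Ω' → ℝ) (hL' : IsLevySeed P' L' ζ a ν)
    (hnonzero : ¬ (∀ᵐ ω ∂P', L' ω = 0))
    (hmean : ∫ ω, L' ω ∂P' = 0)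
    (hfourth : Integrable (fun ω => L' ω ^ 4) P')
    (κ₂ η : ℝ) (hκ₂ : κ₂ = ∫ ω, L' ω ^ 2 ∂P') (hη : η = (∫ ω, L' ω ^ 4 ∂P') / κ₂ ^ 2)
    (f : ℝ × ℝ → ℝ) (Y : ℝ → Ω → ℝ) (hY : IsMMAP P L f Y)
    (Δ : ℝ) (hΔ : 0 < Δ)
    (hf2 : MemLp f 2 volume) (hf4 : MemLp f 4 volume)
    (hper : MemLp (fun z : ℝ × ℝ => ∑' j : ℤ, f (z.1, z.2 + (j : ℝ) * Δ) ^ 2) 2 (stripVolume Δ))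
    (hγ : Summable (fun j : ℤ => |autocov P Y (Δ * (j : ℝ))| ^ 2)) :
    (∀ q : ℤ, MemLp (periodizedProduct f Δ q) 2 (stripVolume Δ)) ∧
    ∀ p q : ℕ,
      (∀ n : ℕ, MemLp (sampleAutocov Y Δ n p) 2 P ∧ MemLp (sampleAutocov Y Δ n q) 2 P) ∧
      Summable (fun l : ℤ => bartlettTerm (autocov P Y) Δ p q l) ∧
      Tendsto (fun n : ℕ => (n : ℝ) * cov[sampleAutocov Y Δ n p, sampleAutocov Y Δ n q; P]) atTop
        (𝓝 ((η - 3) * κ₂ ^ 2 *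
              ∫ z, periodizedProduct f Δ p z * periodizedProduct f Δ q z ∂(stripVolume Δ)
            + ∑' l : ℤ, bartlettTerm (autocov P Y) Δ p q l)) := by
  have hL'4 : MemLp L' 4 P' := by
    refine (integrable_norm_rpow_iff hL'.measurable.aestronglyMeasurable (by norm_num)
      (by norm_num)).1 (hfourth.norm.congr (ae_of_all _ fun ω => ?_))
    simp only [ENNReal.toReal_ofNat, norm_pow]
    exact_mod_cast (Real.rpow_natCast ‖L' ω‖ 4).symm
  -- Needed for `κ₄ = (η - 3)κ₂²`, where `η` is a quotient by `κ₂²`.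
  have hκ0 : κ₂ ≠ 0 := by
    intro h0
    rw [hκ₂, integral_eq_zero_iff_of_nonneg (fun ω => sq_nonneg _)
      (hL'4.mono_exponent (by norm_num : (2 : ENNReal) ≤ 4)).integrable_sq] at h0
    refine hnonzero (h0.mono fun ω hω => ?_)
    simpa using hω
  have h := hL.isFourthOrderRandomMeasure hL' hmean hL'4
  rw [← hκ₂] at h
  have hκ₄ : ∫ ω, L' ω ^ 4 ∂P' - 3 * κ₂ ^ 2 = (η - 3) * κ₂ ^ 2 := by
    rw [hη]; field_simp
  rw [hκ₄] at h
  have hmem := h.memLp_mul_of_isMMAP hf2 hf4 hY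
  have hsample : ∀ n p : ℕ, MemLp (sampleAutocov Y Δ n p) 2 P := fun n p =>
    (memLp_finsetSum _ fun j _ => hmem _ _).const_mul _
  refine ⟨memLp_periodizedProduct hΔ hf2 hper, fun p q => ⟨fun n => ⟨hsample n p, hsample n q⟩,
    summable_bartlettTerm hγ p q, ?_⟩⟩
  have hb := summable_bartlettTerm hγ p q
  have hK := (hasSum_integral_mul_mul_mul hΔ hf2 hf4 hper p q).mul_left ((η - 3) * κ₂ ^ 2)
  -- With `l = k - j` the covariance contains `γ(lΔ)γ((l+q-p)Δ)` and `γ((l+q)Δ)γ((l-p)Δ)`, which by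
  -- evenness of `γ` is the Bartlett term at `-l`; hence the reflected series.
  have hB := (Equiv.neg ℤ).hasSum_iff.2 hb.hasSum
  have hsum := hK.add hB
  have hces := tendsto_cesaro_sum_sub hsum.summable
  rw [hsum.tsum_eq] at hces
  refine hces.congr' ?_
  filter_upwards [eventually_ne_atTop 0] with n hn
  have hn' : (n : ℝ) ≠ 0 := by exact_mod_cast hn
  unfold sampleAutocov
  rw [covariance_const_mul_left, covariance_const_mul_right,
    covariance_fun_sum_fun_sum' (fun j _ => hmem _ _) (fun j _ => hmem _ _),
    ← mul_assoc (n : ℝ), mul_inv_cancel₀ hn', one_mul]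
  congr 1
  refine Finset.sum_congr rfl fun j _ => Finset.sum_congr rfl fun k _ => ?_
  rw [h.covariance_mul_mul_of_isMMAP hf2 hf4 hY]
  have neg := h.autocov_neg hf2 hf4 hY
  simp only [Function.comp_def, Equiv.neg_apply, bartlettTerm]
  push_cast
  rw [show -((k : ℝ) - j) * Δ = -(k * Δ - j * Δ) by ring,
    show (-((k : ℝ) - j) + p - q) * Δ = -((k + q) * Δ - (j + p) * Δ) by ring,
    show (-((k : ℝ) - j) - q) * Δ = -((k + q) * Δ - j * Δ) by ring,
    show (-((k : ℝ) - j) + p) * Δ = -(k * Δ - (j + p) * Δ) by ring,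
    neg, neg, neg, neg,
    show ((j : ℝ) + p) * Δ - j * Δ = p * Δ by ring,
    show (k : ℝ) * Δ - j * Δ = (k - j) * Δ by ring,
    show ((k : ℝ) + q) * Δ - j * Δ = (k - j + q) * Δ by ring]
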